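/- Let $a,b>0$ and $\Omega=(-a,a)\times(-b,b)\subset\mathbb R^2$, with points $(x,y)$. Put $[u,v]=\frac12u_{xx}v_{yy}+\frac12u_{yy}v_{xx}-u_{xy}v_{xy}$. Let $V$ be the set of $\psi\in H^2(\Omega)$ with $\psi_x=0$ at $x=\pm a$ that are periodic in $y$ (the traces of $\psi$ and of $\psi_y$ at $y=b$ and $y=-b$ coincide), and let $X=\{\psi\in V:\int_\Omega\psi=0\}$. A weak solution of $\Delta^2\varphi=f$ with the boundary conditions $\varphi$ periodic in $y$, $\varphi_x=(\Delta\varphi)_x=0$ at $x=\pm a$, and with $\int_\Omega\varphi=0$, is a $\varphi\in X$ with $\int_\Omega\Delta\varphi\,\Delta\psi=\int_\Omega f\psi$ for all $\psi\in V$. For $w\in X$ let $\phi_1,\phi_2,\phi$ be the weak solutions of $$\Delta^2\phi_1=-w_{xx},\qquad \Delta^2\phi_2=-[w,w],\qquad \Delta^2\phi=-[w,w]-w_{xx}$$ in this sense, and set $$\|w\|_X^2=\int_\Omega\bigl((\Delta w)^2+(\Delta\phi_1)^2\bigr),\qquad F_\lambda(w)=\frac12\int_\Omega\bigl((\Delta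 w)^2+(\Delta\phi)^2\bigr)-\frac\lambda2\int_\Omega w_x^2 .$$ Then the following hold. 0. For every $w\in X$ each of these three problems has exactly one weak solution, so that $\phi_1,\phi_2,\phi$ are well defined. 1. There is a constant $C$, depending only on $\Omega$, such that for all $w\in X$ $$\Bigl|\int_\Omega\Delta\phi_1\,\Delta\phi_2\Bigr|\le C\,\|w\|_X^3 .$$ 2. For every $0<\lambda<2$ there is $\varrho>0$ such that $$\inf\{F_\lambda(w): w\in X,\ \|w\|_X=\varrho\}>0 .$$ 3. Consequently, for every $0<\lambda<2$, the unbuckled state $w=0$ is a strict local minimizer of $F_\lambda$ in $X$: there is $r>0$ such that $F_\lambda(w)>F_\lambda(0)$ for all $w\in X$ with $w\ne0$ and $\|w\|_X\le r$. -/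

import Mathlib

open MeasureTheory Set
open scoped ContDiff

namespace VKD

/-- The rectangle `Ω = (-a, a) × (-b, b)`; the first coordinate is the axial variable `x`,
the second the tangential variable `y`. -/
def Om (a b : ℝ) : Set (ℝ × ℝ) := Ioo (-a) a ×ˢ Ioo (-b) b

/-- `L²(Ω)`. -/
abbrev L2 (a b : ℝ) : Type := Lp ℝ 2 ((volume : Measure (ℝ × ℝ)).restrict (Om a b))

/-- The unit vectors of the `x`- and `y`-direction. -/
def ex : ℝ × ℝ := (1, 0)
def ey : ℝ × ℝ := (0, 1)

/-- `∫_Ω (u ∂_e η + v η)`. If `v` is the weak derivative `∂_e u` in `Ω` then, by Green's formula,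
this is the boundary integral `∫_{∂Ω} u η (e · n)` of the trace of `u`. -/
noncomputable def green {a b : ℝ} (e : ℝ × ℝ) (u v : L2 a b) (η : ℝ × ℝ → ℝ) : ℝ :=
  ∫ p in Om a b, (u p * fderiv ℝ η p e + v p * η p)

/-- `v` is the weak derivative of `u` in `Ω` in the direction `e`: the test functions are the
smooth functions with compact support inside `Ω`. -/
def HasWeakDeriv {a b : ℝ} (e : ℝ × ℝ) (u v : L2 a b) : Prop :=
  ∀ η : ℝ × ℝ → ℝ, ContDiff ℝ ∞ η → HasCompactSupport η → tsupport η ⊆ Om a b →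
    green e u v η = 0

/-- `u` (with weak derivative `ux = u_x`) has zero trace on the sides `x = ±a`. The test functions
are smooth up to the boundary, and for them Green's formula reads
`∫_Ω (u η_x + u_x η) = ∫_{-b}^{b} (u(a,y) η(a,y) - u(-a,y) η(-a,y)) dy`. -/
def ZeroTraceX {a b : ℝ} (u ux : L2 a b) : Prop :=
  ∀ η : ℝ × ℝ → ℝ, ContDiff ℝ ∞ η → green ex u ux η = 0

/-- The traces of `u` (with weak derivative `uy = u_y`) on `y = b` and `y = -b` coincide. For
smooth `η` with period `2b` in `y` Green's formula reads
`∫_Ω (u η_y + u_y η) = ∫_{-a}^{a} (u(x,b) - u(x,-b)) η(x,b) dx`. -/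
def MatchingTraceY {a b : ℝ} (u uy : L2 a b) : Prop :=
  ∀ η : ℝ × ℝ → ℝ, ContDiff ℝ ∞ η → (∀ x y : ℝ, η (x, y + 2 * b) = η (x, y)) →
    green ey u uy η = 0

/-- The Sobolev space `H²(Ω)`: a function of `L²(Ω)` together with its (unique) weak partial
derivatives of order one and two, all of them in `L²(Ω)`. -/
@[ext] structure H2 (a b : ℝ) where
  val : L2 a b
  dx : L2 a b
  dy : L2 a b
  dxx : L2 a b
  dxy : L2 a b
  dyy : L2 a b
  weak_dx : HasWeakDeriv ex val dx
  weak_dy : HasWeakDeriv ey val dy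
  weak_dxx : HasWeakDeriv ex dx dxx
  weak_dxy : HasWeakDeriv ey dx dxy
  weak_dyy : HasWeakDeriv ey dy dyy

theorem green_zero {a b : ℝ} (e : ℝ × ℝ) (η : ℝ × ℝ → ℝ) :
    green e (0 : L2 a b) (0 : L2 a b) η = 0 := by
  unfold green
  apply integral_eq_zero_of_ae
  filter_upwards [Lp.coeFn_zero ℝ 2 ((volume : Measure (ℝ × ℝ)).restrict (Om a b))] with p hp
  have h0 : (0 : L2 a b) p = 0 := hp
  rw [h0]
  simp

noncomputable instance {a b : ℝ} : Zero (H2 a b) :=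
  ⟨{ val := 0, dx := 0, dy := 0, dxx := 0, dxy := 0, dyy := 0
     weak_dx := fun η _ _ _ => green_zero ex η
     weak_dy := fun η _ _ _ => green_zero ey η
     weak_dxx := fun η _ _ _ => green_zero ex η
     weak_dxy := fun η _ _ _ => green_zero ey η
     weak_dyy := fun η _ _ _ => green_zero ey η }⟩

/-- The Laplacian `Δw = w_xx + w_yy`. -/
noncomputable def lap {a b : ℝ} (w : H2 a b) : L2 a b := w.dxx + w.dyy

/-- The bracket `[u, v] = ½ u_xx v_yy + ½ u_yy v_xx - u_xy v_xy`. -/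
noncomputable def bracket {a b : ℝ} (u v : H2 a b) : ℝ × ℝ → ℝ := fun p =>
  1 / 2 * (u.dxx p * v.dyy p) + 1 / 2 * (u.dyy p * v.dxx p) - u.dxy p * v.dxy p

/-- The functions of `H²(Ω)` with `w_x = 0` at `x = ±a` that are periodic in `y`, that is, for
which both `w` and `w_y` take the same values at `y = b` and `y = -b`. -/
def V (a b : ℝ) : Set (H2 a b) :=
  {w | ZeroTraceX w.dx w.dxx ∧ MatchingTraceY w.val w.dy ∧ MatchingTraceY w.dy w.dyy}

/-- The space `X`: the functions of `V` with zero integral. -/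
def X (a b : ℝ) : Set (H2 a b) := {w | w ∈ V a b ∧ ∫ p in Om a b, w.val p = 0}

/-- `φ ∈ H²(Ω)` is the weak solution of `Δ²φ = f` in `Ω` with `φ_x = (Δφ)_x = 0` at `x = ±a`,
periodic in `y`, and normalized by `∫_Ω φ = 0`. The condition on `(Δφ)_x` and the periodicity of
the higher derivatives are the natural boundary conditions of this variational form. -/
def IsSol {a b : ℝ} (f : ℝ × ℝ → ℝ) (φ : H2 a b) : Prop :=
  φ ∈ X a b ∧ ∀ ψ ∈ V a b,
    ∫ p in Om a b, lap φ p * lap ψ p = ∫ p in Om a b, f p * ψ.val p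

open Classical in
/-- The weak solution of `Δ²φ = f` (and `0` if there is none). -/
noncomputable def sol {a b : ℝ} (f : ℝ × ℝ → ℝ) : H2 a b :=
  if h : ∃ φ : H2 a b, IsSol f φ then h.choose else 0

/-- Right-hand side of `Δ²φ₁ = -w_xx`. -/
noncomputable def rhs1 {a b : ℝ} (w : H2 a b) : ℝ × ℝ → ℝ := fun p => -(w.dxx p)

/-- Right-hand side of `Δ²φ₂ = -[w, w]`. -/
noncomputable def rhs2 {a b : ℝ} (w : H2 a b) : ℝ × ℝ → ℝ := fun p => -(bracket w w p)

/-- Right-hand side of `Δ²φ = -[w, w] - w_xx`. -/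
noncomputable def rhs {a b : ℝ} (w : H2 a b) : ℝ × ℝ → ℝ := fun p => -(bracket w w p) - w.dxx p

noncomputable def phi1 {a b : ℝ} (w : H2 a b) : H2 a b := sol (rhs1 w)

noncomputable def phi2 {a b : ℝ} (w : H2 a b) : H2 a b := sol (rhs2 w)

/-- The Airy stress function of `w`. -/
noncomputable def phi {a b : ℝ} (w : H2 a b) : H2 a b := sol (rhs w)

/-- `‖w‖_X = (∫_Ω (Δw² + Δφ₁²))^{1/2}`. -/
noncomputable def normX {a b : ℝ} (w : H2 a b) : ℝ :=
  Real.sqrt (∫ p in Om a b, ((lap w p) ^ 2 + (lap (phi1 w) p) ^ 2))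

/-- The stored energy `E(w) = ½ ∫_Ω (Δw² + Δφ²)`. -/
noncomputable def energy {a b : ℝ} (w : H2 a b) : ℝ :=
  1 / 2 * ∫ p in Om a b, ((lap w p) ^ 2 + (lap (phi w) p) ^ 2)

/-- The average axial shortening `S(w) = ½ ∫_Ω w_x²`. -/
noncomputable def shortening {a b : ℝ} (w : H2 a b) : ℝ :=
  1 / 2 * ∫ p in Om a b, (w.dx p) ^ 2

/-- The total potential `F_λ(w) = E(w) - λ S(w)`. -/
noncomputable def F {a b : ℝ} (lam : ℝ) (w : H2 a b) : ℝ := energy w - lam * shortening w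

end VKD

/-! Everything is done in the Fourier basis of Neumann cosines in `x` times periodic functions in
`y`. Zero traces of `w_x` and matching traces of `w` and `w_y` are exactly what makes each
derivative of an element of `V` act on coefficients by a multiplier. Even derivatives in `x` are
expanded in the cosine basis `eB`, odd ones in the sine basis `sB`. Conversely, coefficients `c`
with `(1 + mu) c` square summable define an element of `V` (`exists_mem_V_hasSum`).

In two dimensions `(1 + mu)⁻¹` is square summable. Hence elements of `V` have absolutely convergent
Fourier series, and `exists_sup_bound` controls the supremum of an element of `X` by the `L²` norm
of its Laplacian. By the same summability `Δ²φ = f` is solvable for `f` merely in `L¹` with mean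
zero (`existsUnique_isSol`). This is the class of `[w,w]`, whose integral vanishes because `∫ w_xx
w_yy = ∫ w_xy²`.

Cubic term: the equation of `φ₂` tested with `φ₁` gives `∫ Δφ₁ Δφ₂ = -∫ [w,w] φ₁`. The first factor
is bounded in `L¹` by `2 ∫ (Δw)²`, the second in `L^∞` by a multiple of `‖w‖_X`
(`exists_cubic_bound`).

Threshold 2: the equation of `φ₁` tested with `w` gives `∫ w_x² = ∫ Δw Δφ₁ ≤ ½ ‖w‖_X²`
(`inner_dx_le`). Since `Δφ = Δφ₁ + Δφ₂`, expanding the energy yields `F_λ(w) ≥ ((2 - λ)/4) ‖w‖_X² -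
C ‖w‖_X³`, after dropping `½ ∫ (Δφ₂)²`. For `λ < 2` the quadratic term wins near the origin
(`exists_F_lower_bound`), and both statements about `F_λ` follow. -/

namespace VKD

open Real (cos sin)

/-! ### One-variable trigonometric systems and their orthogonality -/

/-- The axial frequencies `mπ/(2a)`. -/
noncomputable def alpha (a : ℝ) (m : ℕ) : ℝ := m * Real.pi / (2 * a)

/-- The tangential frequencies `nπ/b`. -/
noncomputable def beta (b : ℝ) (n : ℤ) : ℝ := n * Real.pi / b

/-- The Neumann eigenfunctions of `(-a, a)`. -/
noncomputable def cosX (a : ℝ) (m : ℕ) (x : ℝ) : ℝ := cos (alpha a m * (x + a))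

/-- The Dirichlet eigenfunctions of `(-a, a)`. -/
noncomputable def sinX (a : ℝ) (m : ℕ) (x : ℝ) : ℝ := sin (alpha a m * (x + a))

/-- The periodic eigenfunctions of `(-b, b)`, in the real (Hartley) form. -/
noncomputable def casY (b : ℝ) (n : ℤ) (y : ℝ) : ℝ := cos (beta b n * y) + sin (beta b n * y)

@[simp] theorem alpha_zero (a : ℝ) : alpha a 0 = 0 := by simp [alpha]

theorem beta_neg (b : ℝ) (n : ℤ) : beta b (-n) = -beta b n := by simp [beta]; ring

theorem hasDerivAt_cosX (a : ℝ) (m : ℕ) (x : ℝ) :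
    HasDerivAt (cosX a m) (-(alpha a m * sinX a m x)) x := by
  have h : HasDerivAt (fun x : ℝ => alpha a m * (x + a)) (alpha a m * 1) x :=
    ((hasDerivAt_id x).add_const a).const_mul _
  have := h.cos
  unfold cosX sinX
  exact this.congr_deriv (by ring)

theorem hasDerivAt_sinX (a : ℝ) (m : ℕ) (x : ℝ) :
    HasDerivAt (sinX a m) (alpha a m * cosX a m x) x := by
  have h : HasDerivAt (fun x : ℝ => alpha a m * (x + a)) (alpha a m * 1) x :=
    ((hasDerivAt_id x).add_const a).const_mul _
  have := h.sin
  unfold cosX sinX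
  exact this.congr_deriv (by ring)

/-- The Hartley form keeps a single real family indexed by `ℤ`: differentiation only reflects the
index, which is the origin of `flip` below. -/
theorem hasDerivAt_casY (b : ℝ) (n : ℤ) (y : ℝ) :
    HasDerivAt (casY b n) (beta b n * casY b (-n) y) y := by
  have h : HasDerivAt (fun y : ℝ => beta b n * y) (beta b n * 1) y :=
    (hasDerivAt_id y).const_mul _
  have := h.cos.add h.sin
  unfold casY
  have e : beta b n * (cos (beta b (-n) * y) + sin (beta b (-n) * y)) =
      -sin (beta b n * y) * (beta b n * 1) + cos (beta b n * y) * (beta b n * 1) := by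
    rw [beta_neg, neg_mul, Real.cos_neg, Real.sin_neg]
    ring
  rw [e]
  exact this

theorem contDiff_cosX (a : ℝ) (m : ℕ) : ContDiff ℝ ∞ (cosX a m) := by
  unfold cosX; fun_prop

theorem contDiff_sinX (a : ℝ) (m : ℕ) : ContDiff ℝ ∞ (sinX a m) := by
  unfold sinX; fun_prop

theorem contDiff_casY (b : ℝ) (n : ℤ) : ContDiff ℝ ∞ (casY b n) := by
  unfold casY; fun_prop

theorem sinX_neg (a : ℝ) (m : ℕ) : sinX a m (-a) = 0 := by simp [sinX]

theorem sinX_self {a : ℝ} (ha : 0 < a) (m : ℕ) : sinX a m a = 0 := by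
  have : alpha a m * (a + a) = m * Real.pi := by unfold alpha; field_simp; ring
  rw [sinX, this, Real.sin_nat_mul_pi]

theorem casY_periodic {b : ℝ} (hb : 0 < b) (n : ℤ) (y : ℝ) :
    casY b n (y + 2 * b) = casY b n y := by
  have : beta b n * (y + 2 * b) = beta b n * y + n * (2 * Real.pi) := by unfold beta; field_simp
  rw [casY, this, Real.cos_add_int_mul_two_pi, Real.sin_add_int_mul_two_pi, casY]

theorem integral_cos_shift {a : ℝ} (ha : 0 < a) (j : ℤ) :
    ∫ x in Ioo (-a) a, cos (j * Real.pi / (2 * a) * (x + a)) = if j = 0 then 2 * a else 0 := by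
  rw [← integral_Ioc_eq_integral_Ioo, ← intervalIntegral.integral_of_le (by linarith)]
  split_ifs with h
  · simp [h]; ring
  · have hj : (j : ℝ) ≠ 0 := by exact_mod_cast h
    set c : ℝ := j * Real.pi / (2 * a) with hc
    have hc0 : c ≠ 0 := by positivity
    have hd : ∀ x ∈ uIcc (-a) a, HasDerivAt (fun x => sin (c * (x + a)) / c) (cos (c * (x + a))) x := by
      intro x _
      have h : HasDerivAt (fun x : ℝ => c * (x + a)) (c * 1) x :=
        ((hasDerivAt_id x).add_const a).const_mul _
      have := h.sin.div_const c
      exact this.congr_deriv (by field_simp)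
    rw [intervalIntegral.integral_eq_sub_of_hasDerivAt hd
      (Continuous.intervalIntegrable (by fun_prop) _ _)]
    have : c * (a + a) = j * Real.pi := by rw [hc]; field_simp; ring
    simp [this, Real.sin_int_mul_pi]

theorem integral_cos_period {b : ℝ} (hb : 0 < b) (j : ℤ) :
    ∫ y in Ioo (-b) b, cos (beta b j * y) = if j = 0 then 2 * b else 0 := by
  rw [← integral_Ioc_eq_integral_Ioo, ← intervalIntegral.integral_of_le (by linarith)]
  split_ifs with h
  · simp [h, beta]; ring
  · have hj : (j : ℝ) ≠ 0 := by exact_mod_cast h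
    have hc0 : beta b j ≠ 0 := by unfold beta; positivity
    have hd : ∀ x ∈ uIcc (-b) b,
        HasDerivAt (fun x => sin (beta b j * x) / beta b j) (cos (beta b j * x)) x := by
      intro x _
      have h : HasDerivAt (fun x : ℝ => beta b j * x) (beta b j * 1) x :=
        (hasDerivAt_id x).const_mul _
      have := h.sin.div_const (beta b j)
      exact this.congr_deriv (by field_simp)
    rw [intervalIntegral.integral_eq_sub_of_hasDerivAt hd
      (Continuous.intervalIntegrable (by fun_prop) _ _)]
    have : beta b j * b = j * Real.pi := by unfold beta; field_simp
    simp [this, Real.sin_int_mul_pi]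

theorem integral_sin_symm {b : ℝ} (hb : 0 < b) (c : ℝ) : ∫ y in Ioo (-b) b, sin (c * y) = 0 := by
  rw [← integral_Ioc_eq_integral_Ioo, ← intervalIntegral.integral_of_le (by linarith)]
  have h := intervalIntegral.integral_comp_neg (a := -b) (b := b) (fun y => sin (c * y))
  simp only [mul_neg, Real.sin_neg, neg_neg, intervalIntegral.integral_neg] at h
  linarith

theorem integrableOn_Ioo_of_continuous {f : ℝ → ℝ} (hf : Continuous f) (r s : ℝ) :
    IntegrableOn f (Ioo r s) :=
  (hf.integrableOn_Icc (a := r) (b := s)).mono_set Ioo_subset_Icc_self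

theorem integral_cosX_mul {a : ℝ} (ha : 0 < a) (m k : ℕ) :
    ∫ x in Ioo (-a) a, cosX a m x * cosX a k x =
      if m = k then (if m = 0 then 2 * a else a) else 0 := by
  have e : ∀ x, cosX a m x * cosX a k x =
      1 / 2 * (cos (((m - k : ℤ) : ℝ) * Real.pi / (2 * a) * (x + a)) +
        cos (((m + k : ℤ) : ℝ) * Real.pi / (2 * a) * (x + a))) := by
    intro x
    have h1 : ((m - k : ℤ) : ℝ) * Real.pi / (2 * a) * (x + a) =
      alpha a m * (x + a) - alpha a k * (x + a) := by unfold alpha; push_cast; ring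
    have h2 : ((m + k : ℤ) : ℝ) * Real.pi / (2 * a) * (x + a) =
      alpha a m * (x + a) + alpha a k * (x + a) := by unfold alpha; push_cast; ring
    rw [h1, h2, Real.cos_add, Real.cos_sub, cosX, cosX]; ring
  simp_rw [e]
  rw [integral_const_mul, integral_add (integrableOn_Ioo_of_continuous (by fun_prop) _ _)
    (integrableOn_Ioo_of_continuous (by fun_prop) _ _), integral_cos_shift ha, integral_cos_shift ha]
  split_ifs <;> first | omega | ring

theorem integral_sinX_mul {a : ℝ} (ha : 0 < a) (m k : ℕ) :
    ∫ x in Ioo (-a) a, sinX a (m + 1) x * sinX a (k + 1) x = if m = k then a else 0 := by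
  have e : ∀ x, sinX a (m + 1) x * sinX a (k + 1) x =
      1 / 2 * (cos (((m - k : ℤ) : ℝ) * Real.pi / (2 * a) * (x + a)) -
        cos (((m + k + 2 : ℤ) : ℝ) * Real.pi / (2 * a) * (x + a))) := by
    intro x
    have h1 : ((m - k : ℤ) : ℝ) * Real.pi / (2 * a) * (x + a) =
      alpha a (m + 1) * (x + a) - alpha a (k + 1) * (x + a) := by unfold alpha; push_cast; ring
    have h2 : ((m + k + 2 : ℤ) : ℝ) * Real.pi / (2 * a) * (x + a) =
      alpha a (m + 1) * (x + a) + alpha a (k + 1) * (x + a) := by unfold alpha; push_cast; ring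
    rw [h1, h2, Real.cos_add, Real.cos_sub, sinX, sinX]; ring
  simp_rw [e]
  rw [integral_const_mul, integral_sub (integrableOn_Ioo_of_continuous (by fun_prop) _ _)
    (integrableOn_Ioo_of_continuous (by fun_prop) _ _), integral_cos_shift ha, integral_cos_shift ha]
  split_ifs <;> first | omega | ring

/-- The product is a cosine of the difference frequency plus a sine of the sum frequency. The sine
is odd and integrates to zero, so only the diagonal survives. -/
theorem integral_casY_mul {b : ℝ} (hb : 0 < b) (n k : ℤ) :
    ∫ y in Ioo (-b) b, casY b n y * casY b k y = if n = k then 2 * b else 0 := by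
  have e : ∀ y, casY b n y * casY b k y = cos (beta b (n - k) * y) + sin (beta b (n + k) * y) := by
    intro y
    have h1 : beta b (n - k) * y = beta b n * y - beta b k * y := by unfold beta; push_cast; ring
    have h2 : beta b (n + k) * y = beta b n * y + beta b k * y := by unfold beta; push_cast; ring
    rw [h1, h2, Real.cos_sub, Real.sin_add, casY, casY]; ring
  simp_rw [e]
  rw [integral_add (integrableOn_Ioo_of_continuous (by fun_prop) _ _)
    (integrableOn_Ioo_of_continuous (by fun_prop) _ _), integral_cos_period hb,
    integral_sin_symm hb]
  split_ifs <;> first | omega | ring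

theorem abs_cosX_le (a : ℝ) (m : ℕ) (x : ℝ) : |cosX a m x| ≤ 1 := Real.abs_cos_le_one _

theorem abs_sinX_le (a : ℝ) (m : ℕ) (x : ℝ) : |sinX a m x| ≤ 1 := Real.abs_sin_le_one _

theorem abs_casY_le (b : ℝ) (n : ℤ) (y : ℝ) : |casY b n y| ≤ 2 :=
  (abs_add_le _ _).trans ((add_le_add (Real.abs_cos_le_one _) (Real.abs_sin_le_one _)).trans_eq
    one_add_one_eq_two)

/-! ### Completeness of the trigonometric systems against integrable functions -/

/-- If an integrable `h` is orthogonal to all sums `e_n ∘ φ + e_n ∘ ψ` of Fourier monomials, it is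
orthogonal to all sums `f ∘ φ + f ∘ ψ` with `f` continuous on the circle. -/
theorem integral_mul_circle_eq_zero {T : ℝ} [Fact (0 < T)] {μ : Measure ℝ} {h : ℝ → ℝ}
    (hh : Integrable h μ) {φ ψ : ℝ → ℝ} (hφ : Continuous φ) (hψ : Continuous ψ)
    (h0 : ∀ n : ℤ, ∫ x, (h x : ℂ) * (fourier n (φ x : AddCircle T) + fourier n (ψ x : AddCircle T)) ∂μ = 0)
    (f : C(AddCircle T, ℂ)) : ∫ x, (h x : ℂ) * (f (φ x) + f (ψ x)) ∂μ = 0 := by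
  have hc : ∀ f : C(AddCircle T, ℂ), Continuous fun x : ℝ =>
      f (φ x : AddCircle T) + f (ψ x : AddCircle T) := fun f =>
    (f.continuous.comp ((AddCircle.continuous_mk' T).comp hφ)).add
      (f.continuous.comp ((AddCircle.continuous_mk' T).comp hψ))
  have hbd : ∀ (f : C(AddCircle T, ℂ)) (x : ℝ), ‖f (φ x : AddCircle T) + f (ψ x : AddCircle T)‖ ≤ 2 * ‖f‖ := by
    intro f x
    refine (norm_add_le _ _).trans ?_
    linarith [f.norm_coe_le_norm (φ x : AddCircle T), f.norm_coe_le_norm (ψ x : AddCircle T)]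
  have hi : ∀ f : C(AddCircle T, ℂ), Integrable
      (fun x => (h x : ℂ) * (f (φ x : AddCircle T) + f (ψ x : AddCircle T))) μ := fun f =>
    hh.ofReal.mul_bdd (hc f).aestronglyMeasurable (Filter.Eventually.of_forall (hbd f))
  let L₀ : C(AddCircle T, ℂ) →ₗ[ℂ] ℂ :=
    { toFun := fun f => ∫ x, (h x : ℂ) * (f (φ x) + f (ψ x)) ∂μ
      map_add' := by
        intro f g
        rw [← integral_add (hi f) (hi g)]
        congr 1; ext x; simp only [ContinuousMap.add_apply]; ring
      map_smul' := by
        intro c f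
        rw [RingHom.id_apply, smul_eq_mul, ← integral_const_mul]
        congr 1; ext x; simp only [ContinuousMap.smul_apply, smul_eq_mul]; ring }
  let L : C(AddCircle T, ℂ) →L[ℂ] ℂ := L₀.mkContinuous (2 * ∫ x, ‖h x‖ ∂μ) (by
    intro f
    refine (norm_integral_le_integral_norm _).trans ?_
    rw [mul_right_comm, ← integral_const_mul]
    refine integral_mono (hi f).norm (hh.norm.const_mul _) fun x => ?_
    simp only [norm_mul, Complex.norm_real]
    rw [mul_comm]
    exact mul_le_mul_of_nonneg_right (hbd f x) (norm_nonneg _))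
  -- The functional is continuous for the sup norm and vanishes on the Fourier monomials, whose span
  -- is dense.
  have hL : L = 0 := by
    refine ContinuousLinearMap.ext_on (s := range (@fourier T)) ?_ ?_
    · rw [dense_iff_closure_eq, ← Submodule.topologicalClosure_coe, span_fourier_closure_eq_top]
      rfl
    · rintro _ ⟨n, rfl⟩
      exact h0 n
  exact congrArg (fun M : C(AddCircle T, ℂ) →L[ℂ] ℂ => M f) hL

/-- Tests supported inside the interval vanish at both ends, so they can be transplanted
continuously to a circle. -/
theorem ae_eq_zero_of_integral_test {h : ℝ → ℝ} {r s : ℝ} (hh : IntegrableOn h (Ioo r s))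
    (h0 : ∀ g : ℝ → ℝ, Continuous g → tsupport g ⊆ Ioo r s → ∫ x in Ioo r s, h x * g x = 0) :
    h =ᵐ[volume.restrict (Ioo r s)] 0 := by
  have := isOpen_Ioo.ae_eq_zero_of_integral_contDiff_smul_eq_zero (hh.locallyIntegrableOn)
    (fun g hg _ hgs => by
      rw [← setIntegral_eq_integral_of_forall_compl_eq_zero (s := Ioo r s), ← h0 g hg.continuous hgs]
      · simp_rw [smul_eq_mul, mul_comm]
      · intro x hx
        rw [image_eq_zero_of_notMem_tsupport (fun h => hx (hgs h)), zero_smul])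
  exact (ae_restrict_iff' measurableSet_Ioo).2 this

theorem integral_mul_cos_sin {h : ℝ → ℝ} {μ : Measure ℝ} (hh : Integrable h μ) (c : ℝ) :
    ∫ x, (h x : ℂ) * Complex.exp (c * x * Complex.I) ∂μ =
      ((∫ x, h x * cos (c * x) ∂μ : ℝ) : ℂ) + ((∫ x, h x * sin (c * x) ∂μ : ℝ) : ℂ) * Complex.I := by
  have hc : Integrable (fun x => h x * cos (c * x)) μ :=
    hh.mul_bdd (by fun_prop) (Filter.Eventually.of_forall fun x => Real.abs_cos_le_one _)
  have hs : Integrable (fun x => h x * sin (c * x)) μ :=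
    hh.mul_bdd (by fun_prop) (Filter.Eventually.of_forall fun x => Real.abs_sin_le_one _)
  rw [← integral_complex_ofReal, ← integral_complex_ofReal, ← integral_mul_const, ← integral_add hc.ofReal
    (hs.ofReal.mul_const _)]
  congr 1; ext x
  rw [Complex.exp_mul_I]
  push_cast
  ring

/-- The indices `n` and `-n` together recover the cosine and the sine moments, hence all complex
exponentials on the circle of length `2b`. -/
theorem casY_complete {b : ℝ} (hb : 0 < b) {h : ℝ → ℝ} (hh : IntegrableOn h (Ioo (-b) b))
    (h0 : ∀ n : ℤ, ∫ y in Ioo (-b) b, h y * casY b n y = 0) :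
    h =ᵐ[volume.restrict (Ioo (-b) b)] 0 := by
  have : Fact (0 < 2 * b) := ⟨by linarith⟩
  have hc : ∀ c : ℝ, IntegrableOn (fun x => h x * cos (c * x)) (Ioo (-b) b) := fun c =>
    hh.mul_bdd (by fun_prop) (Filter.Eventually.of_forall fun x => Real.abs_cos_le_one _)
  have hs : ∀ c : ℝ, IntegrableOn (fun x => h x * sin (c * x)) (Ioo (-b) b) := fun c =>
    hh.mul_bdd (by fun_prop) (Filter.Eventually.of_forall fun x => Real.abs_sin_le_one _)
  have key : ∀ n : ℤ, (∫ y in Ioo (-b) b, h y * cos (beta b n * y)) = 0 ∧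
      (∫ y in Ioo (-b) b, h y * sin (beta b n * y)) = 0 := by
    intro n
    have h1 := h0 n
    have h2 := h0 (-n)
    simp only [casY, beta_neg, neg_mul, Real.cos_neg, Real.sin_neg, mul_add, mul_neg] at h1 h2
    rw [integral_add (hc _) (hs _)] at h1
    rw [integral_add (hc _) (by exact (hs _).neg), integral_neg] at h2
    constructor <;> linarith
  refine ae_eq_zero_of_integral_test hh fun g hg hgs => ?_
  have hgb : g (-b) = 0 := image_eq_zero_of_notMem_tsupport fun h => (lt_irrefl _ (hgs h).1)
  have hgb' : g b = 0 := image_eq_zero_of_notMem_tsupport fun h => (lt_irrefl _ (hgs h).2)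
  let f : C(AddCircle (2 * b), ℂ) := ⟨AddCircle.liftIco (2 * b) (-b) (fun t => (g t : ℂ)),
    AddCircle.liftIco_continuous (by
      have : -b + 2 * b = b := by ring
      rw [this, hgb, hgb']) (by fun_prop)⟩
  have hf := integral_mul_circle_eq_zero (T := 2 * b) (μ := volume.restrict (Ioo (-b) b)) hh
    continuous_id continuous_id (by
      intro n
      have : ∀ x : ℝ, (h x : ℂ) * (fourier n ((id x : ℝ) : AddCircle (2 * b)) +
          fourier n ((id x : ℝ) : AddCircle (2 * b))) =
          2 * ((h x : ℂ) * Complex.exp ((beta b n : ℝ) * x * Complex.I)) := by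
        intro x
        rw [id, fourier_coe_apply]
        have e : 2 * (Real.pi : ℂ) * Complex.I * n * x / ((2 * b : ℝ) : ℂ) =
            ((beta b n : ℝ) : ℂ) * x * Complex.I := by
          have hb' : (b : ℂ) ≠ 0 := by exact_mod_cast hb.ne'
          unfold beta; push_cast; field_simp
        rw [e]; ring
      simp_rw [this]
      rw [integral_const_mul, integral_mul_cos_sin hh, (key n).1, (key n).2]
      simp) f
  have e : ∀ y ∈ Ioo (-b) b, (h y : ℂ) * (f ((id y : ℝ) : AddCircle (2 * b)) + f ((id y : ℝ) : AddCircle (2 * b))) =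
      ((2 * (h y * g y) : ℝ) : ℂ) := by
    intro y hy
    have : f (y : AddCircle (2 * b)) = g y :=
      AddCircle.liftIco_coe_apply (p := 2 * b) (a := -b) (f := fun t => (g t : ℂ)) ⟨hy.1.le, by linarith [hy.2]⟩
    rw [id, this]; push_cast; ring
  rw [setIntegral_congr_fun measurableSet_Ioo e, integral_complex_ofReal, integral_const_mul] at hf
  have : (2 * ∫ y in Ioo (-b) b, h y * g y) = 0 := by exact_mod_cast hf
  linarith

/-- On the circle of length `4a` the test function occupies one half and is extended by zero to the
other. Symmetrizing under `x + a ↦ -(x + a)` turns exponentials into the available cosines, and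
leaves the test function unchanged on the first half. -/
theorem cosX_complete {a : ℝ} (ha : 0 < a) {h : ℝ → ℝ} (hh : IntegrableOn h (Ioo (-a) a))
    (h0 : ∀ m : ℕ, ∫ x in Ioo (-a) a, h x * cosX a m x = 0) :
    h =ᵐ[volume.restrict (Ioo (-a) a)] 0 := by
  have : Fact (0 < 4 * a) := ⟨by linarith⟩
  refine ae_eq_zero_of_integral_test hh fun g hg hgs => ?_
  have hg0 : ∀ x, x ∉ Ioo (-a) a → g x = 0 := fun x hx =>
    image_eq_zero_of_notMem_tsupport fun h => hx (hgs h)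
  let f : C(AddCircle (4 * a), ℂ) := ⟨AddCircle.liftIco (4 * a) 0 (fun t => (g (t - a) : ℂ)),
    AddCircle.liftIco_continuous (by
      rw [hg0 (0 - a) (fun h => by linarith [h.1]), hg0 (0 + 4 * a - a) (fun h => by linarith [h.2])])
      (by fun_prop)⟩
  have hf := integral_mul_circle_eq_zero (T := 4 * a) (μ := volume.restrict (Ioo (-a) a)) hh
    (φ := fun x => x + a) (ψ := fun x => -(x + a)) (by fun_prop) (by fun_prop) (by
      intro n
      have : ∀ x : ℝ, (h x : ℂ) * (fourier n ((x + a : ℝ) : AddCircle (4 * a)) +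
          fourier n ((-(x + a) : ℝ) : AddCircle (4 * a))) =
          ((2 * (h x * cosX a n.natAbs x) : ℝ) : ℂ) := by
        intro x
        have ha' : (a : ℂ) ≠ 0 := by exact_mod_cast ha.ne'
        rw [fourier_coe_apply, fourier_coe_apply]
        have e1 : 2 * (Real.pi : ℂ) * Complex.I * n * ((x + a : ℝ) : ℂ) / ((4 * a : ℝ) : ℂ) =
            ((n * Real.pi / (2 * a) * (x + a) : ℝ) : ℂ) * Complex.I := by
          push_cast; field_simp; ring
        have e2 : 2 * (Real.pi : ℂ) * Complex.I * n * ((-(x + a) : ℝ) : ℂ) / ((4 * a : ℝ) : ℂ) =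
            -((n * Real.pi / (2 * a) * (x + a) : ℝ) : ℂ) * Complex.I := by
          push_cast; field_simp; ring
        have e3 : cosX a n.natAbs x = cos (n * Real.pi / (2 * a) * (x + a)) := by
          rw [cosX, alpha, Nat.cast_natAbs]
          rcases abs_choice n with h | h <;> rw [h]
          rw [← Real.cos_neg]; congr 1; push_cast; ring
        rw [e1, e2, ← Complex.two_cos, e3]
        push_cast
        ring
      simp_rw [this]
      rw [integral_complex_ofReal, integral_const_mul, h0]
      simp) f
  have e : ∀ x ∈ Ioo (-a) a, (h x : ℂ) * (f ((x + a : ℝ) : AddCircle (4 * a)) +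
      f ((-(x + a) : ℝ) : AddCircle (4 * a))) = ((h x * g x : ℝ) : ℂ) := by
    intro x hx
    have e1 : f ((x + a : ℝ) : AddCircle (4 * a)) = g (x + a - a) :=
      AddCircle.liftIco_coe_apply (p := 4 * a) (a := 0) (f := fun t => (g (t - a) : ℂ)) ⟨by linarith [hx.1], by linarith [hx.2]⟩
    have e2 : f ((-(x + a) : ℝ) : AddCircle (4 * a)) = g (-(x + a) + 4 * a - a) := by
      rw [← AddCircle.coe_add_period]
      exact AddCircle.liftIco_coe_apply (p := 4 * a) (a := 0) (f := fun t => (g (t - a) : ℂ)) ⟨by linarith [hx.2], by linarith [hx.1]⟩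
    -- The reflected point falls in the half where the extension vanishes: `2a - x > a`.
    rw [e1, e2, hg0 (-(x + a) + 4 * a - a) (fun h => by linarith [h.2, hx.2])]
    simp
  rw [setIntegral_congr_fun measurableSet_Ioo e, integral_complex_ofReal] at hf
  exact_mod_cast hf

/-- Products of two complete systems are complete. -/
theorem ae_eq_zero_of_integral_mul_prod {α β I J : Type*} [MeasurableSpace α] [MeasurableSpace β]
    [Countable J] {μ : Measure α} {ν : Measure β} [SFinite μ] [SFinite ν]
    {A : I → α → ℝ} {B : J → β → ℝ}
    (hA : ∀ k : α → ℝ, Integrable k μ → (∀ i, ∫ x, k x * A i x ∂μ = 0) → k =ᵐ[μ] 0)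
    (hB : ∀ k : β → ℝ, Integrable k ν → (∀ j, ∫ y, k y * B j y ∂ν = 0) → k =ᵐ[ν] 0)
    (hAm : ∀ i, Measurable (A i)) (hBm : ∀ j, Measurable (B j)) {c : ℝ}
    (hAc : ∀ i x, |A i x| ≤ c) (hBc : ∀ j y, |B j y| ≤ c)
    {h : α × β → ℝ} (hh : Integrable h (μ.prod ν))
    (h0 : ∀ i j, ∫ p, h p * (A i p.1 * B j p.2) ∂μ.prod ν = 0) : h =ᵐ[μ.prod ν] 0 := by
  have hhB : ∀ j, Integrable (fun p : α × β => h p * B j p.2) (μ.prod ν) := fun j =>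
    hh.mul_bdd ((hBm j).comp measurable_snd).aestronglyMeasurable
      (Filter.Eventually.of_forall fun p => hBc j p.2)
  have hhBA : ∀ i j, Integrable (fun p : α × β => h p * B j p.2 * A i p.1) (μ.prod ν) := fun i j =>
    (hhB j).mul_bdd ((hAm i).comp measurable_fst).aestronglyMeasurable
      (Filter.Eventually.of_forall fun p => hAc i p.1)
  have hz : ∀ j, (fun x => ∫ y, h (x, y) * B j y ∂ν) =ᵐ[μ] 0 := by
    intro j
    refine hA _ (hhB j).integral_prod_left fun i => ?_
    rw [← h0 i j]
    have : ∀ p : α × β, h p * (A i p.1 * B j p.2) = h p * B j p.2 * A i p.1 := fun p => by ring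
    simp_rw [this]
    rw [integral_prod _ (hhBA i j)]
    simp_rw [integral_mul_const]
  -- Countability of `J` gives one null set of `x` outside which all the moments in `y` vanish at
  -- once.
  have hs : ∀ᵐ x ∂μ, (fun y => h (x, y)) =ᵐ[ν] 0 := by
    filter_upwards [ae_all_iff.2 hz, hh.prod_right_ae] with x hx hxi
    exact hB _ hxi hx
  have hn : ∫ p, ‖h p‖ ∂μ.prod ν = 0 := by
    rw [integral_prod _ hh.norm]
    refine integral_eq_zero_of_ae ?_
    filter_upwards [hs] with x hx
    refine integral_eq_zero_of_ae ?_
    filter_upwards [hx] with y hy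
    simpa using hy
  have := (integral_eq_zero_iff_of_nonneg (fun p => norm_nonneg (h p)) hh.norm).1 hn
  filter_upwards [this] with p hp
  simpa using hp

theorem volume_restrict_Om (a b : ℝ) : (volume : Measure (ℝ × ℝ)).restrict (Om a b) =
    (volume.restrict (Ioo (-a) a)).prod (volume.restrict (Ioo (-b) b)) := by
  rw [Measure.prod_restrict, Om, Measure.volume_eq_prod]

theorem cosX_mul_casY_complete {a b : ℝ} (ha : 0 < a) (hb : 0 < b) {h : ℝ × ℝ → ℝ}
    (hh : IntegrableOn h (Om a b))
    (h0 : ∀ m n, ∫ p in Om a b, h p * (cosX a m p.1 * casY b n p.2) = 0) :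
    h =ᵐ[volume.restrict (Om a b)] 0 := by
  rw [IntegrableOn, volume_restrict_Om] at hh
  simp_rw [volume_restrict_Om] at h0 ⊢
  exact ae_eq_zero_of_integral_mul_prod (A := cosX a) (B := casY b) (c := 2)
    (fun k hk => cosX_complete ha hk) (fun k hk => casY_complete hb hk)
    (fun m => (contDiff_cosX a m).continuous.measurable)
    (fun n => (contDiff_casY b n).continuous.measurable)
    (fun m x => (abs_cosX_le a m x).trans one_le_two) (abs_casY_le b) hh h0

/-- Reduction to the cosine system: the first sine times a cosine is a difference of sines, so `h`
times the first sine is orthogonal to every cosine. The first sine is positive inside the interval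
and can be divided out. -/
theorem sinX_mul_casY_complete {a b : ℝ} (ha : 0 < a) (hb : 0 < b) {h : ℝ × ℝ → ℝ}
    (hh : IntegrableOn h (Om a b))
    (h0 : ∀ m n, ∫ p in Om a b, h p * (sinX a (m + 1) p.1 * casY b n p.2) = 0) :
    h =ᵐ[volume.restrict (Om a b)] 0 := by
  have hm : ∀ m, Continuous fun p : ℝ × ℝ => sinX a m p.1 := fun m =>
    (contDiff_sinX a m).continuous.comp continuous_fst
  have hn : ∀ n, Continuous fun p : ℝ × ℝ => casY b n p.2 := fun n =>
    (contDiff_casY b n).continuous.comp continuous_snd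
  have hi : ∀ m n, IntegrableOn (fun p => h p * (sinX a m p.1 * casY b n p.2)) (Om a b) :=
    fun m n => hh.mul_bdd ((hm m).mul (hn n)).aestronglyMeasurable
      (Filter.Eventually.of_forall fun p => by
        rw [norm_mul]
        exact mul_le_mul (abs_sinX_le _ _ _) (abs_casY_le _ _ _) (norm_nonneg _) zero_le_one)
  have h0' : ∀ m n, ∫ p in Om a b, h p * (sinX a m p.1 * casY b n p.2) = 0 := by
    intro m n
    rcases m with _ | m
    · simp [sinX]
    · exact h0 m n
  have key := cosX_mul_casY_complete ha hb (h := fun p => h p * sinX a 1 p.1)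
    (hh.mul_bdd (hm 1).aestronglyMeasurable
      (Filter.Eventually.of_forall fun p => abs_sinX_le _ _ _)) (by
    intro m n
    rcases m with _ | m
    · rw [← h0' 1 n]
      congr 1; ext p; simp [cosX]; ring
    · have : ∀ p : ℝ × ℝ, h p * sinX a 1 p.1 * (cosX a (m + 1) p.1 * casY b n p.2) =
          1 / 2 * (h p * (sinX a (m + 2) p.1 * casY b n p.2) - h p * (sinX a m p.1 * casY b n p.2)) := by
        intro p
        have e1 : alpha a (m + 2) * (p.1 + a) = alpha a (m + 1) * (p.1 + a) + alpha a 1 * (p.1 + a) := by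
          unfold alpha; push_cast; ring
        have e2 : alpha a m * (p.1 + a) = alpha a (m + 1) * (p.1 + a) - alpha a 1 * (p.1 + a) := by
          unfold alpha; push_cast; ring
        rw [sinX, sinX, sinX, e1, e2, Real.sin_add, Real.sin_sub, cosX]
        ring
      simp_rw [this]
      rw [integral_const_mul, integral_sub (hi _ _) (hi _ _), h0', h0']
      ring)
  have hOm : MeasurableSet (Om a b) := measurableSet_Ioo.prod measurableSet_Ioo
  filter_upwards [key, ae_restrict_mem hOm] with p hp hpO
  have hs : 0 < sinX a 1 p.1 := by
    have hx := (mem_prod.1 hpO).1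
    refine Real.sin_pos_of_pos_of_lt_pi (mul_pos ?_ (by linarith [hx.1])) ?_
    · unfold alpha; have := Real.pi_pos; positivity
    · have : alpha a 1 * (p.1 + a) < alpha a 1 * (a + a) :=
        mul_lt_mul_of_pos_left (by linarith [hx.2]) (by unfold alpha; have := Real.pi_pos; positivity)
      refine this.trans_eq ?_
      unfold alpha; field_simp; push_cast; ring
  exact (mul_eq_zero.1 hp).resolve_right hs.ne'

/-! ### The two Hilbert bases of `L²(Ω)` -/

theorem measurableSet_Om (a b : ℝ) : MeasurableSet (Om a b) :=
  measurableSet_Ioo.prod measurableSet_Ioo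

instance isFiniteMeasure_Om (a b : ℝ) :
    IsFiniteMeasure ((volume : Measure (ℝ × ℝ)).restrict (Om a b)) := by
  rw [volume_restrict_Om]; infer_instance

theorem exists_bound_Om (a b : ℝ) {f : ℝ × ℝ → ℝ} (hf : Continuous f) :
    ∃ C, ∀ p ∈ Om a b, ‖f p‖ ≤ C := by
  obtain ⟨C, hC⟩ := (isCompact_Icc.prod isCompact_Icc : IsCompact (Icc (-a) a ×ˢ Icc (-b) b)).exists_bound_of_continuousOn
    hf.continuousOn
  exact ⟨C, fun p hp => hC p (prod_mono Ioo_subset_Icc_self Ioo_subset_Icc_self hp)⟩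

theorem memLp_of_continuous {a b : ℝ} {f : ℝ × ℝ → ℝ} (hf : Continuous f) :
    MemLp f 2 ((volume : Measure (ℝ × ℝ)).restrict (Om a b)) := by
  obtain ⟨C, hC⟩ := exists_bound_Om a b hf
  exact MemLp.of_bound hf.aestronglyMeasurable C
    ((ae_restrict_mem (measurableSet_Om a b)).mono hC)

/-- The class in `L²(Ω)` of a continuous function on the plane. -/
noncomputable def toL2 (a b : ℝ) {f : ℝ × ℝ → ℝ} (hf : Continuous f) : L2 a b :=
  (memLp_of_continuous hf).toLp f

theorem coeFn_toL2 {a b : ℝ} {f : ℝ × ℝ → ℝ} (hf : Continuous f) :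
    toL2 a b hf =ᵐ[volume.restrict (Om a b)] f := MemLp.coeFn_toLp _

theorem inner_eq {a b : ℝ} (u v : L2 a b) : inner ℝ u v = ∫ p in Om a b, u p * v p := by
  rw [L2.inner_def]
  congr 1; ext p
  simp [mul_comm]

theorem inner_toL2 {a b : ℝ} (u : L2 a b) {f : ℝ × ℝ → ℝ} (hf : Continuous f) :
    inner ℝ u (toL2 a b hf) = ∫ p in Om a b, u p * f p := by
  rw [inner_eq]
  refine integral_congr_ae ?_
  filter_upwards [coeFn_toL2 (a := a) (b := b) hf] with p hp
  rw [hp]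

theorem integrable_L2 {a b : ℝ} (u : L2 a b) : IntegrableOn u (Om a b) :=
  (Lp.memLp u).integrable one_le_two

theorem integrable_mul_L2 {a b : ℝ} (u v : L2 a b) : IntegrableOn (fun p => u p * v p) (Om a b) :=
  (Lp.memLp u).integrable_mul (Lp.memLp v)

theorem integrable_mul_of_continuous {a b : ℝ} {h f : ℝ × ℝ → ℝ} (hh : IntegrableOn h (Om a b))
    (hf : Continuous f) : IntegrableOn (fun p => h p * f p) (Om a b) := by
  obtain ⟨C, hC⟩ := exists_bound_Om a b hf
  exact hh.mul_bdd hf.aestronglyMeasurable ((ae_restrict_mem (measurableSet_Om a b)).mono hC)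

theorem integral_Om_mul {a b : ℝ} (f g : ℝ → ℝ) :
    ∫ p in Om a b, f p.1 * g p.2 = (∫ x in Ioo (-a) a, f x) * ∫ y in Ioo (-b) b, g y := by
  rw [Om, Measure.volume_eq_prod, setIntegral_prod_mul]

/-- The normalizing constant of the Neumann eigenfunctions. -/
noncomputable def nrm (a b : ℝ) (m : ℕ) : ℝ :=
  if m = 0 then (Real.sqrt (4 * a * b))⁻¹ else (Real.sqrt (2 * a * b))⁻¹

theorem nrm_sq {a b : ℝ} (ha : 0 < a) (hb : 0 < b) (m : ℕ) :
    nrm a b m * nrm a b m * ((if m = 0 then 2 * a else a) * (2 * b)) = 1 := by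
  have h4 : 0 < 4 * a * b := by positivity
  have h2 : 0 < 2 * a * b := by positivity
  unfold nrm
  split_ifs
  · rw [← mul_inv, Real.mul_self_sqrt h4.le]; field_simp; norm_num
  · rw [← mul_inv, Real.mul_self_sqrt h2.le]; field_simp

/-- The orthonormal eigenfunctions of the Laplacian (Neumann in `x`, periodic in `y`). -/
noncomputable def eF (a b : ℝ) (k : ℕ × ℤ) (p : ℝ × ℝ) : ℝ :=
  nrm a b k.1 * (cosX a k.1 p.1 * casY b k.2 p.2)

/-- The orthonormal eigenfunctions of the Laplacian (Dirichlet in `x`, periodic in `y`). -/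
noncomputable def sF (a b : ℝ) (k : ℕ × ℤ) (p : ℝ × ℝ) : ℝ :=
  nrm a b (k.1 + 1) * (sinX a (k.1 + 1) p.1 * casY b k.2 p.2)

theorem contDiff_eF (a b : ℝ) (k : ℕ × ℤ) : ContDiff ℝ ∞ (eF a b k) :=
  contDiff_const.mul (((contDiff_cosX a k.1).comp contDiff_fst).mul
    ((contDiff_casY b k.2).comp contDiff_snd))

theorem contDiff_sF (a b : ℝ) (k : ℕ × ℤ) : ContDiff ℝ ∞ (sF a b k) :=
  contDiff_const.mul (((contDiff_sinX a (k.1 + 1)).comp contDiff_fst).mul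
    ((contDiff_casY b k.2).comp contDiff_snd))

noncomputable def eL (a b : ℝ) (k : ℕ × ℤ) : L2 a b := toL2 a b (contDiff_eF a b k).continuous

noncomputable def sL (a b : ℝ) (k : ℕ × ℤ) : L2 a b := toL2 a b (contDiff_sF a b k).continuous

theorem inner_eL {a b : ℝ} (u : L2 a b) (k : ℕ × ℤ) :
    inner ℝ u (eL a b k) = ∫ p in Om a b, u p * eF a b k p := inner_toL2 u _

theorem inner_sL {a b : ℝ} (u : L2 a b) (k : ℕ × ℤ) :
    inner ℝ u (sL a b k) = ∫ p in Om a b, u p * sF a b k p := inner_toL2 u _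

theorem orthonormal_eL {a b : ℝ} (ha : 0 < a) (hb : 0 < b) : Orthonormal ℝ (eL a b) := by
  rw [orthonormal_iff_ite]
  rintro ⟨m, n⟩ ⟨k, l⟩
  have h : inner ℝ (eL a b (m, n)) (eL a b (k, l)) =
      nrm a b m * nrm a b k * ∫ p in Om a b, (cosX a m p.1 * cosX a k p.1) * (casY b n p.2 * casY b l p.2) := by
    rw [inner_eL, ← integral_const_mul]
    refine integral_congr_ae ?_
    filter_upwards [coeFn_toL2 (a := a) (b := b) (contDiff_eF a b (m, n)).continuous] with p hp
    rw [eL, hp, eF, eF]; ring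
  rw [h, integral_Om_mul (fun x => cosX a m x * cosX a k x) (fun y => casY b n y * casY b l y),
    integral_cosX_mul ha, integral_casY_mul hb]
  by_cases h1 : m = k
  · by_cases h2 : n = l
    · subst h1 h2
      simpa using nrm_sq ha hb m
    · simp [h2]
  · simp [h1]

theorem orthonormal_sL {a b : ℝ} (ha : 0 < a) (hb : 0 < b) : Orthonormal ℝ (sL a b) := by
  rw [orthonormal_iff_ite]
  rintro ⟨m, n⟩ ⟨k, l⟩
  have h : inner ℝ (sL a b (m, n)) (sL a b (k, l)) =
      nrm a b (m + 1) * nrm a b (k + 1) *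
        ∫ p in Om a b, (sinX a (m + 1) p.1 * sinX a (k + 1) p.1) * (casY b n p.2 * casY b l p.2) := by
    rw [inner_sL, ← integral_const_mul]
    refine integral_congr_ae ?_
    filter_upwards [coeFn_toL2 (a := a) (b := b) (contDiff_sF a b (m, n)).continuous] with p hp
    rw [sL, hp, sF, sF]; ring
  rw [h, integral_Om_mul (fun x => sinX a (m + 1) x * sinX a (k + 1) x)
    (fun y => casY b n y * casY b l y), integral_sinX_mul ha, integral_casY_mul hb]
  by_cases h1 : m = k
  · by_cases h2 : n = l
    · subst h1 h2
      simpa using nrm_sq ha hb (m + 1)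
    · simp [h2]
  · simp [h1]

theorem nrm_ne_zero {a b : ℝ} (ha : 0 < a) (hb : 0 < b) (m : ℕ) : nrm a b m ≠ 0 := fun h => by
  simpa [h] using nrm_sq ha hb m

theorem eF_complete {a b : ℝ} (ha : 0 < a) (hb : 0 < b) {h : ℝ × ℝ → ℝ}
    (hh : IntegrableOn h (Om a b)) (h0 : ∀ k, ∫ p in Om a b, h p * eF a b k p = 0) :
    h =ᵐ[volume.restrict (Om a b)] 0 := by
  refine cosX_mul_casY_complete ha hb hh fun m n => ?_
  have := h0 (m, n)
  simp_rw [eF, mul_left_comm _ (nrm a b m)] at this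
  rw [integral_const_mul] at this
  exact (mul_eq_zero.1 this).resolve_left (nrm_ne_zero ha hb m)

theorem sF_complete {a b : ℝ} (ha : 0 < a) (hb : 0 < b) {h : ℝ × ℝ → ℝ}
    (hh : IntegrableOn h (Om a b)) (h0 : ∀ k, ∫ p in Om a b, h p * sF a b k p = 0) :
    h =ᵐ[volume.restrict (Om a b)] 0 := by
  refine sinX_mul_casY_complete ha hb hh fun m n => ?_
  have := h0 (m, n)
  simp_rw [sF, mul_left_comm _ (nrm a b (m + 1))] at this
  rw [integral_const_mul] at this
  exact (mul_eq_zero.1 this).resolve_left (nrm_ne_zero ha hb (m + 1))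

theorem orthogonal_span_eq_bot {a b : ℝ} {v : ℕ × ℤ → L2 a b}
    (h : ∀ u : L2 a b, (∀ k, inner ℝ u (v k) = 0) → u = 0) : (Submodule.span ℝ (range v))ᗮ = ⊥ := by
  rw [Submodule.eq_bot_iff]
  intro u hu
  refine h u fun k => ?_
  rw [real_inner_comm]
  exact (Submodule.mem_orthogonal _ _).1 hu _ (Submodule.subset_span ⟨k, rfl⟩)

/-- The Neumann eigenfunctions as a Hilbert basis of `L²(Ω)`. -/
noncomputable def eB {a b : ℝ} (ha : 0 < a) (hb : 0 < b) : HilbertBasis (ℕ × ℤ) ℝ (L2 a b) :=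
  HilbertBasis.mkOfOrthogonalEqBot (orthonormal_eL ha hb) <| orthogonal_span_eq_bot fun u hu =>
    (Lp.eq_zero_iff_ae_eq_zero).2 (eF_complete ha hb (integrable_L2 u) fun k => by
      rw [← inner_eL, hu])

/-- The Dirichlet eigenfunctions as a Hilbert basis of `L²(Ω)`. -/
noncomputable def sB {a b : ℝ} (ha : 0 < a) (hb : 0 < b) : HilbertBasis (ℕ × ℤ) ℝ (L2 a b) :=
  HilbertBasis.mkOfOrthogonalEqBot (orthonormal_sL ha hb) <| orthogonal_span_eq_bot fun u hu =>
    (Lp.eq_zero_iff_ae_eq_zero).2 (sF_complete ha hb (integrable_L2 u) fun k => by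
      rw [← inner_sL, hu])

@[simp] theorem eB_apply {a b : ℝ} (ha : 0 < a) (hb : 0 < b) (k : ℕ × ℤ) :
    eB ha hb k = eL a b k := by
  rw [eB, HilbertBasis.coe_mkOfOrthogonalEqBot]

@[simp] theorem sB_apply {a b : ℝ} (ha : 0 < a) (hb : 0 < b) (k : ℕ × ℤ) :
    sB ha hb k = sL a b k := by
  rw [sB, HilbertBasis.coe_mkOfOrthogonalEqBot]

/-! ### Cutoffs and Green's formula for test functions vanishing only on the sides -/

open Filter Topology

/-- Smooth cutoff functions exhausting the interval `(-r, r)`. -/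
noncomputable def chi (r : ℝ) (k : ℕ) (x : ℝ) : ℝ := Real.smoothTransition (k * (r ^ 2 - x ^ 2) - 1)

theorem contDiff_chi (r : ℝ) (k : ℕ) : ContDiff ℝ ∞ (chi r k) :=
  Real.smoothTransition.contDiff.comp (by fun_prop)

theorem abs_chi_le (r : ℝ) (k : ℕ) (x : ℝ) : |chi r k x| ≤ 1 := by
  rw [chi, abs_of_nonneg (Real.smoothTransition.nonneg _)]
  exact Real.smoothTransition.le_one _

theorem sq_sub_sq_pos {r x : ℝ} (hx : x ∈ Ioo (-r) r) : 0 < r ^ 2 - x ^ 2 := by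
  nlinarith [mul_pos (neg_lt_iff_pos_add.1 hx.1) (sub_pos.2 hx.2)]

theorem exists_isCompact_chi {r : ℝ} (hr : 0 < r) (k : ℕ) :
    ∃ K : Set ℝ, IsCompact K ∧ K ⊆ Ioo (-r) r ∧ ∀ x ∉ K, chi r k x = 0 := by
  refine ⟨{x | x ∈ Icc (-r) r ∧ 1 ≤ k * (r ^ 2 - x ^ 2)}, ?_, ?_, ?_⟩
  · refine IsCompact.of_isClosed_subset (isCompact_Icc (a := -r) (b := r)) ?_ fun x hx => hx.1
    exact isClosed_Icc.and (isClosed_le (by fun_prop) (by fun_prop))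
  · rintro x ⟨⟨h1, h2⟩, h⟩
    refine ⟨lt_of_le_of_ne h1 ?_, lt_of_le_of_ne h2 ?_⟩
    · rintro rfl; norm_num at h
    · rintro rfl; norm_num at h
  · intro x hx
    refine Real.smoothTransition.zero_of_nonpos ?_
    by_cases h : x ∈ Icc (-r) r
    · linarith [not_le.1 fun h' => hx ⟨h, h'⟩]
    · have : r ^ 2 - x ^ 2 ≤ 0 := by
        by_contra! h'
        have := abs_lt_of_sq_lt_sq (sub_pos.1 h') hr.le
        exact h ⟨(abs_lt.1 this).1.le, (abs_lt.1 this).2.le⟩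
      linarith [mul_nonpos_of_nonneg_of_nonpos (Nat.cast_nonneg (α := ℝ) k) this]

theorem chi_eventuallyEq_one {r x : ℝ} (hx : x ∈ Ioo (-r) r) :
    ∀ᶠ k in atTop, chi r k =ᶠ[𝓝 x] fun _ => 1 := by
  have hq := sq_sub_sq_pos hx
  obtain ⟨N, hN⟩ := exists_nat_gt (2 / (r ^ 2 - x ^ 2))
  filter_upwards [eventually_ge_atTop N] with k hk
  have hk' : 2 < k * (r ^ 2 - x ^ 2) := by
    rw [div_lt_iff₀ hq] at hN
    exact hN.trans_le (mul_le_mul_of_nonneg_right (by exact_mod_cast hk) hq.le)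
  have : ∀ᶠ z in 𝓝 x, 2 < k * (r ^ 2 - z ^ 2) :=
    (isOpen_lt (f := fun _ => (2 : ℝ)) (g := fun z : ℝ => k * (r ^ 2 - z ^ 2))
      (by fun_prop) (by fun_prop)).mem_nhds hk'
  filter_upwards [this] with z hz
  exact Real.smoothTransition.one_of_one_le (by linarith)

/-- The derivative vanishes outside `[0, 1]`. The factor `t + 1` becomes `k (r² - x²)` after the
substitution used in `chi`. -/
theorem exists_bound_deriv_smoothTransition :
    ∃ M, ∀ t, |deriv Real.smoothTransition t * (t + 1)| ≤ M := by
  have hc : Continuous fun t => deriv Real.smoothTransition t * (t + 1) :=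
    ((Real.smoothTransition.contDiff (n := 1)).continuous_deriv le_rfl).mul (by fun_prop)
  obtain ⟨M, hM⟩ := (isCompact_Icc (a := (0 : ℝ)) (b := 1)).exists_bound_of_continuousOn hc.continuousOn
  refine ⟨M, fun t => ?_⟩
  have hM0 : 0 ≤ M := (norm_nonneg _).trans (hM 0 (by simp))
  rcases lt_or_ge t 0 with h | h
  · have : Real.smoothTransition =ᶠ[𝓝 t] fun _ => 0 := by
      filter_upwards [Iio_mem_nhds h] with z hz
      exact Real.smoothTransition.zero_of_nonpos hz.le
    rw [this.deriv_eq]; simpa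
  rcases lt_or_ge 1 t with h' | h'
  · have : Real.smoothTransition =ᶠ[𝓝 t] fun _ => 1 := by
      filter_upwards [Ioi_mem_nhds h'] with z hz
      exact Real.smoothTransition.one_of_one_le hz.le
    rw [this.deriv_eq]; simpa
  · exact hM t ⟨h, h'⟩

/-- The derivative grows like `k`, but only where `r² - x²` is of order `1/k`; the weight makes the
bound uniform in `k`. -/
theorem exists_bound_deriv_chi {r : ℝ} (hr : 0 < r) :
    ∃ C, 0 ≤ C ∧ ∀ (k : ℕ), ∀ x ∈ Ioo (-r) r, |deriv (chi r k) x| * (r ^ 2 - x ^ 2) ≤ C := by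
  obtain ⟨M, hM⟩ := exists_bound_deriv_smoothTransition
  have hM0 : 0 ≤ M := (abs_nonneg _).trans (hM 0)
  refine ⟨M * (2 * r), by positivity, fun k x hx => ?_⟩
  have h1 : HasDerivAt (fun x : ℝ => k * (r ^ 2 - x ^ 2) - 1) (k * (-(2 * x))) x := by
    have := ((((hasDerivAt_id x).pow 2).const_sub (r ^ 2)).const_mul (k : ℝ)).sub_const 1
    exact this.congr_deriv (by simp)
  have h2 : HasDerivAt (chi r k)
      (deriv Real.smoothTransition (k * (r ^ 2 - x ^ 2) - 1) * (k * (-(2 * x)))) x :=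
    HasDerivAt.comp x ((Real.smoothTransition.contDiff (n := 1)).differentiable one_ne_zero
      _).hasDerivAt h1
  have hq := sq_sub_sq_pos hx
  have hx' : |-(2 * x)| ≤ 2 * r := by
    rw [abs_neg, abs_mul, abs_two]
    linarith [abs_lt.2 hx]
  rw [h2.deriv]
  have e : |deriv Real.smoothTransition (k * (r ^ 2 - x ^ 2) - 1) * (k * (-(2 * x)))| * (r ^ 2 - x ^ 2) =
      |deriv Real.smoothTransition (k * (r ^ 2 - x ^ 2) - 1) * (k * (r ^ 2 - x ^ 2) - 1 + 1)| *
        |-(2 * x)| := by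
    rw [← abs_of_pos hq, ← abs_mul, ← abs_mul]
    simp only [abs_of_pos hq]
    congr 1; ring
  rw [e]
  exact mul_le_mul (hM _) hx' (abs_nonneg _) hM0

/-- Apply the mean value inequality from the nearer endpoint. The distance to the other endpoint is
at least `r`, which accounts for the constant `M / r`. -/
theorem exists_abs_le_mul_sq_sub_sq {r : ℝ} (hr : 0 < r) {f : ℝ → ℝ} (hf : ContDiff ℝ ∞ f)
    (hl : f (-r) = 0) (hu : f r = 0) :
    ∃ C, 0 ≤ C ∧ ∀ x ∈ Ioo (-r) r, |f x| ≤ C * (r ^ 2 - x ^ 2) := by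
  have hc : Continuous (deriv f) := hf.continuous_deriv (by simp)
  obtain ⟨M, hM⟩ := (isCompact_Icc (a := -r) (b := r)).exists_bound_of_continuousOn hc.continuousOn
  have hM0 : 0 ≤ M := (norm_nonneg _).trans (hM 0 ⟨by linarith, hr.le⟩)
  have hd : ∀ x ∈ Icc (-r) r, DifferentiableAt ℝ f x := fun x _ => hf.differentiable (by simp) x
  refine ⟨M / r, by positivity, fun x hx => ?_⟩
  have hxI := Ioo_subset_Icc_self hx
  have h1 := Convex.norm_image_sub_le_of_norm_deriv_le hd hM (convex_Icc _ _)
    (left_mem_Icc.2 (by linarith)) hxI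
  have h2 := Convex.norm_image_sub_le_of_norm_deriv_le hd hM (convex_Icc _ _)
    (right_mem_Icc.2 (by linarith)) hxI
  rw [hl, sub_zero, Real.norm_eq_abs, Real.norm_eq_abs, abs_of_pos (by linarith [hx.1] : 0 < x - -r)] at h1
  rw [hu, sub_zero, Real.norm_eq_abs, Real.norm_eq_abs, abs_of_neg (by linarith [hx.2] : x - r < 0)] at h2
  have hp : 0 < r + x := by linarith [hx.1]
  have hm : 0 < r - x := by linarith [hx.2]
  rw [div_mul_eq_mul_div, le_div_iff₀ hr]
  have e : M * (r ^ 2 - x ^ 2) = M * ((r - x) * (r + x)) := by ring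
  rw [e]
  rcases le_total 0 x with h | h
  · nlinarith [mul_le_mul_of_nonneg_right h2 hr.le, mul_nonneg (mul_nonneg hM0 hm.le) h]
  · nlinarith [mul_le_mul_of_nonneg_right h1 hr.le, mul_nonneg (mul_nonneg hM0 hp.le) (neg_nonneg.2 h)]

theorem exists_bound_Ioo {f : ℝ → ℝ} (hf : Continuous f) (r : ℝ) :
    ∃ C, 0 ≤ C ∧ ∀ x ∈ Ioo (-r) r, |f x| ≤ C := by
  obtain ⟨M, hM⟩ := (isCompact_Icc (a := -r) (b := r)).exists_bound_of_continuousOn hf.continuousOn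
  exact ⟨max M 0, le_max_right _ _, fun x hx =>
    (hM x (Ioo_subset_Icc_self hx)).trans (le_max_left _ _)⟩

theorem fderiv_tensor_ex {f g : ℝ → ℝ} (hf : Differentiable ℝ f) (hg : Differentiable ℝ g)
    (p : ℝ × ℝ) : fderiv ℝ (fun p : ℝ × ℝ => f p.1 * g p.2) p ex = deriv f p.1 * g p.2 := by
  have h1 := (hf p.1).hasDerivAt.comp_hasFDerivAt p (hasFDerivAt_fst (𝕜 := ℝ) (E := ℝ) (F := ℝ))
  have h2 := (hg p.2).hasDerivAt.comp_hasFDerivAt p (hasFDerivAt_snd (𝕜 := ℝ) (E := ℝ) (F := ℝ))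
  have := (h1.mul h2).fderiv
  change fderiv ℝ ((f ∘ Prod.fst) * (g ∘ Prod.snd)) p ex = _
  rw [this]
  simp [ex, mul_comm]

theorem fderiv_tensor_ey {f g : ℝ → ℝ} (hf : Differentiable ℝ f) (hg : Differentiable ℝ g)
    (p : ℝ × ℝ) : fderiv ℝ (fun p : ℝ × ℝ => f p.1 * g p.2) p ey = f p.1 * deriv g p.2 := by
  have h1 := (hf p.1).hasDerivAt.comp_hasFDerivAt p (hasFDerivAt_fst (𝕜 := ℝ) (E := ℝ) (F := ℝ))
  have h2 := (hg p.2).hasDerivAt.comp_hasFDerivAt p (hasFDerivAt_snd (𝕜 := ℝ) (E := ℝ) (F := ℝ))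
  have := (h1.mul h2).fderiv
  change fderiv ℝ ((f ∘ Prod.fst) * (g ∘ Prod.snd)) p ey = _
  rw [this]
  simp [ey]

/-- Green's formula for a weak derivative in the `x`-direction and a test function that vanishes
on the sides `x = ±a` only. -/
theorem HasWeakDeriv.green_ex_tensor {a b : ℝ} (ha : 0 < a) (hb : 0 < b) {u v : L2 a b}
    (h : HasWeakDeriv ex u v) {f g : ℝ → ℝ} (hf : ContDiff ℝ ∞ f) (hg : ContDiff ℝ ∞ g)
    (hl : f (-a) = 0) (hr : f a = 0) : green ex u v (fun p => f p.1 * g p.2) = 0 := by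
  have hfd : Differentiable ℝ f := hf.differentiable (by simp)
  have hgd : Differentiable ℝ g := hg.differentiable (by simp)
  have hχd : ∀ r k, Differentiable ℝ (chi r k) := fun r k => (contDiff_chi r k).differentiable (by simp)
  have hfχ : ∀ k, ContDiff ℝ ∞ fun x => f x * chi a k x := fun k => hf.mul (contDiff_chi a k)
  have hgχ : ∀ k, ContDiff ℝ ∞ fun y => g y * chi b k y := fun k => hg.mul (contDiff_chi b k)
  have hd : ∀ k x, deriv (fun x => f x * chi a k x) x = deriv f x * chi a k x + f x * deriv (chi a k) x :=
    fun k x => deriv_fun_mul (hfd x) (hχd a k x)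
  obtain ⟨Cf, hCf0, hCf⟩ := exists_bound_Ioo hf.continuous a
  obtain ⟨Cd, hCd0, hCd⟩ := exists_bound_Ioo (hf.continuous_deriv (by simp)) a
  obtain ⟨Cg, hCg0, hCg⟩ := exists_bound_Ioo hg.continuous b
  obtain ⟨Cq, hCq0, hCq⟩ := exists_abs_le_mul_sq_sub_sq ha hf hl hr
  obtain ⟨Cχ, hCχ0, hCχ⟩ := exists_bound_deriv_chi ha
  let η : ℕ → ℝ × ℝ → ℝ := fun k p => (f p.1 * chi a k p.1) * (g p.2 * chi b k p.2)
  have hη : ∀ k, ContDiff ℝ ∞ (η k) := fun k =>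
    ((hfχ k).comp contDiff_fst).mul ((hgχ k).comp contDiff_snd)
  have hη0 : ∀ k, green ex u v (η k) = 0 := by
    intro k
    obtain ⟨K, hK, hKs, hK0⟩ := exists_isCompact_chi ha k
    obtain ⟨K', hK', hKs', hK0'⟩ := exists_isCompact_chi hb k
    have hz : ∀ p ∉ K ×ˢ K', η k p = 0 := by
      intro p hp
      by_cases h1 : p.1 ∈ K
      · have h2 : p.2 ∉ K' := fun h2 => hp ⟨h1, h2⟩
        simp [η, hK0' _ h2]
      · simp [η, hK0 _ h1]
    refine h (η k) (hη k) (HasCompactSupport.intro (hK.prod hK') hz) ?_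
    refine (closure_minimal (fun p hp => ?_) (hK.prod hK').isClosed).trans (prod_mono hKs hKs')
    by_contra hp'
    exact hp (hz p hp')
  have hder : ∀ k p, fderiv ℝ (η k) p ex =
      (deriv f p.1 * chi a k p.1 + f p.1 * deriv (chi a k) p.1) * (g p.2 * chi b k p.2) := by
    intro k p
    rw [← hd]
    exact fderiv_tensor_ex ((hfχ k).differentiable (by simp)) ((hgχ k).differentiable (by simp)) p
  have hder' : ∀ p, fderiv ℝ (fun p : ℝ × ℝ => f p.1 * g p.2) p ex = deriv f p.1 * g p.2 :=
    fderiv_tensor_ex hfd hgd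
  -- Dominated convergence. The dangerous term `f χ'` stays bounded because `f` vanishes to first
  -- order at `±a`, compensating the growth of `χ'`. The cutoff in `y` is not differentiated, so `g`
  -- needs no boundary condition.
  have hlim : Tendsto (fun k => green ex u v (η k)) atTop
      (𝓝 (green ex u v (fun p => f p.1 * g p.2))) := by
    refine tendsto_integral_of_dominated_convergence
      (fun p => |u p| * ((Cd * 1 + Cq * Cχ) * (Cg * 1)) + |v p| * ((Cf * 1) * (Cg * 1))) ?_ ?_ ?_ ?_
    · intro k
      have h1 : Continuous fun p => fderiv ℝ (η k) p ex :=
        ((hη k).continuous_fderiv (by simp)).clm_apply continuous_const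
      exact ((integrable_mul_of_continuous (integrable_L2 u) h1).add
        (integrable_mul_of_continuous (integrable_L2 v) (hη k).continuous)).aestronglyMeasurable
    · exact ((integrable_L2 u).abs.mul_const _).add ((integrable_L2 v).abs.mul_const _)
    · intro k
      filter_upwards [ae_restrict_mem (measurableSet_Om a b)] with p hp
      obtain ⟨hx, hy⟩ := mem_prod.1 hp
      have hgb : |g p.2 * chi b k p.2| ≤ Cg * 1 := by
        rw [abs_mul]
        exact mul_le_mul (hCg _ hy) (abs_chi_le _ _ _) (abs_nonneg _) hCg0
      have hfb : |f p.1 * chi a k p.1| ≤ Cf * 1 := by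
        rw [abs_mul]
        exact mul_le_mul (hCf _ hx) (abs_chi_le _ _ _) (abs_nonneg _) hCf0
      have hdb : |deriv f p.1 * chi a k p.1| ≤ Cd * 1 := by
        rw [abs_mul]
        exact mul_le_mul (hCd _ hx) (abs_chi_le _ _ _) (abs_nonneg _) hCd0
      have hqb : |f p.1 * deriv (chi a k) p.1| ≤ Cq * Cχ := by
        rw [abs_mul]
        calc |f p.1| * |deriv (chi a k) p.1|
            ≤ Cq * (a ^ 2 - p.1 ^ 2) * |deriv (chi a k) p.1| :=
              mul_le_mul_of_nonneg_right (hCq _ hx) (abs_nonneg _)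
          _ = Cq * (|deriv (chi a k) p.1| * (a ^ 2 - p.1 ^ 2)) := by ring
          _ ≤ Cq * Cχ := mul_le_mul_of_nonneg_left (hCχ k _ hx) hCq0
      rw [hder, Real.norm_eq_abs]
      refine (abs_add_le _ _).trans (add_le_add ?_ ?_)
      · rw [abs_mul, abs_mul (_ + _)]
        exact mul_le_mul_of_nonneg_left (mul_le_mul ((abs_add_le _ _).trans (add_le_add hdb hqb)) hgb
          (abs_nonneg _) (by positivity)) (abs_nonneg _)
      · rw [abs_mul]
        refine mul_le_mul_of_nonneg_left ?_ (abs_nonneg _)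
        simp only [η]
        rw [abs_mul]
        exact mul_le_mul hfb hgb (abs_nonneg _) (by positivity)
    · filter_upwards [ae_restrict_mem (measurableSet_Om a b)] with p hp
      obtain ⟨hx, hy⟩ := mem_prod.1 hp
      refine tendsto_const_nhds.congr' ?_
      filter_upwards [chi_eventuallyEq_one hx, chi_eventuallyEq_one hy] with k h1 h2
      rw [hder, hder', h1.deriv_eq, h1.eq_of_nhds]
      simp only [η]
      rw [h1.eq_of_nhds, h2.eq_of_nhds]
      simp
  simp_rw [hη0] at hlim
  exact tendsto_nhds_unique hlim tendsto_const_nhds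

/-! ### Fourier coefficients of the weak derivatives -/

/-- The Dirichlet eigenfunctions, indexed like the Neumann eigenfunctions. -/
noncomputable def sNF (a b : ℝ) (k : ℕ × ℤ) (p : ℝ × ℝ) : ℝ :=
  nrm a b k.1 * (sinX a k.1 p.1 * casY b k.2 p.2)

theorem contDiff_sNF (a b : ℝ) (k : ℕ × ℤ) : ContDiff ℝ ∞ (sNF a b k) :=
  contDiff_const.mul (((contDiff_sinX a k.1).comp contDiff_fst).mul
    ((contDiff_casY b k.2).comp contDiff_snd))

noncomputable def sN (a b : ℝ) (k : ℕ × ℤ) : L2 a b := toL2 a b (contDiff_sNF a b k).continuous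

theorem sN_zero (a b : ℝ) (n : ℤ) : sN a b (0, n) = 0 := by
  rw [Lp.eq_zero_iff_ae_eq_zero]
  filter_upwards [coeFn_toL2 (a := a) (b := b) (contDiff_sNF a b (0, n)).continuous] with p hp
  rw [sN, hp]
  simp [sNF, sinX]

/-- Reflection of the tangential frequency. -/
def flip (k : ℕ × ℤ) : ℕ × ℤ := (k.1, -k.2)

@[simp] theorem flip_flip (k : ℕ × ℤ) : flip (flip k) = k := by simp [flip]

theorem fderiv_eF_ex (a b : ℝ) (k : ℕ × ℤ) (p : ℝ × ℝ) :
    fderiv ℝ (eF a b k) p ex = -alpha a k.1 * sNF a b k p := by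
  have h : eF a b k = fun p : ℝ × ℝ => (nrm a b k.1 * cosX a k.1 p.1) * casY b k.2 p.2 := by
    ext p; rw [eF, mul_assoc]
  rw [h, fderiv_tensor_ex (f := fun x => nrm a b k.1 * cosX a k.1 x)
    (((contDiff_cosX a k.1).differentiable (by simp)).const_mul _)
    ((contDiff_casY b k.2).differentiable (by simp)),
    ((hasDerivAt_cosX a k.1 p.1).const_mul _).deriv, sNF]
  ring

theorem fderiv_sNF_ex (a b : ℝ) (k : ℕ × ℤ) (p : ℝ × ℝ) :
    fderiv ℝ (sNF a b k) p ex = alpha a k.1 * eF a b k p := by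
  have h : sNF a b k = fun p : ℝ × ℝ => (nrm a b k.1 * sinX a k.1 p.1) * casY b k.2 p.2 := by
    ext p; rw [sNF, mul_assoc]
  rw [h, fderiv_tensor_ex (f := fun x => nrm a b k.1 * sinX a k.1 x)
    (((contDiff_sinX a k.1).differentiable (by simp)).const_mul _)
    ((contDiff_casY b k.2).differentiable (by simp)),
    ((hasDerivAt_sinX a k.1 p.1).const_mul _).deriv, eF]
  ring

theorem fderiv_eF_ey (a b : ℝ) (k : ℕ × ℤ) (p : ℝ × ℝ) :
    fderiv ℝ (eF a b k) p ey = beta b k.2 * eF a b (flip k) p := by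
  have h : eF a b k = fun p : ℝ × ℝ => (nrm a b k.1 * cosX a k.1 p.1) * casY b k.2 p.2 := by
    ext p; rw [eF, mul_assoc]
  rw [h, fderiv_tensor_ey (f := fun x => nrm a b k.1 * cosX a k.1 x)
    (((contDiff_cosX a k.1).differentiable (by simp)).const_mul _)
    ((contDiff_casY b k.2).differentiable (by simp)),
    (hasDerivAt_casY b k.2 p.2).deriv, eF, flip]
  ring

theorem fderiv_sNF_ey (a b : ℝ) (k : ℕ × ℤ) (p : ℝ × ℝ) :
    fderiv ℝ (sNF a b k) p ey = beta b k.2 * sNF a b (flip k) p := by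
  have h : sNF a b k = fun p : ℝ × ℝ => (nrm a b k.1 * sinX a k.1 p.1) * casY b k.2 p.2 := by
    ext p; rw [sNF, mul_assoc]
  rw [h, fderiv_tensor_ey (f := fun x => nrm a b k.1 * sinX a k.1 x)
    (((contDiff_sinX a k.1).differentiable (by simp)).const_mul _)
    ((contDiff_casY b k.2).differentiable (by simp)),
    (hasDerivAt_casY b k.2 p.2).deriv, sNF, flip]
  ring

theorem continuous_fderiv_apply {η : ℝ × ℝ → ℝ} (hη : ContDiff ℝ ∞ η) (e : ℝ × ℝ) :
    Continuous fun p => fderiv ℝ η p e :=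
  (hη.continuous_fderiv (by simp)).clm_apply continuous_const

theorem green_eq_inner {a b : ℝ} (e : ℝ × ℝ) (u v : L2 a b) {η : ℝ × ℝ → ℝ} (hη : ContDiff ℝ ∞ η) :
    green e u v η = inner ℝ u (toL2 a b (continuous_fderiv_apply hη e)) +
      inner ℝ v (toL2 a b hη.continuous) := by
  rw [inner_toL2, inner_toL2, ← integral_add
    (integrable_mul_of_continuous (integrable_L2 u) (continuous_fderiv_apply hη e))
    (integrable_mul_of_continuous (integrable_L2 v) hη.continuous), green]

theorem green_of_fderiv_eq {a b : ℝ} {e : ℝ × ℝ} (u v : L2 a b) {η η' : ℝ × ℝ → ℝ}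
    (hη : ContDiff ℝ ∞ η) (hη' : Continuous η') {c : ℝ} (h : ∀ p, fderiv ℝ η p e = c * η' p) :
    green e u v η = c * inner ℝ u (toL2 a b hη') + inner ℝ v (toL2 a b hη.continuous) := by
  rw [green_eq_inner e u v hη, inner_toL2, inner_toL2, inner_toL2, ← integral_const_mul]
  simp_rw [h, mul_left_comm]

/-- The sines vanish at `x = ±a`, so the interior weak derivative suffices and no trace condition on
`u` enters. -/
theorem HasWeakDeriv.inner_sN {a b : ℝ} (ha : 0 < a) (hb : 0 < b) {u v : L2 a b}
    (h : HasWeakDeriv ex u v) (k : ℕ × ℤ) :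
    inner ℝ v (sN a b k) = -(alpha a k.1 * inner ℝ u (eL a b k)) := by
  have h1 := h.green_ex_tensor ha hb (f := fun x => nrm a b k.1 * sinX a k.1 x) (g := casY b k.2)
    (contDiff_const.mul (contDiff_sinX a k.1)) (contDiff_casY b k.2)
    (by simp [sinX_neg]) (by simp [sinX_self ha])
  have e : (fun p : ℝ × ℝ => nrm a b k.1 * sinX a k.1 p.1 * casY b k.2 p.2) = sNF a b k := by
    ext p; rw [sNF, mul_assoc]
  rw [e, green_of_fderiv_eq u v (contDiff_sNF a b k) (contDiff_eF a b k).continuous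
    (fderiv_sNF_ex a b k)] at h1
  rw [sN, eL]
  linarith

/-- Cosines do not vanish on the sides; here the zero trace of `u` is what removes the boundary
term. -/
theorem ZeroTraceX.inner_eL {a b : ℝ} {u v : L2 a b} (h : ZeroTraceX u v) (k : ℕ × ℤ) :
    inner ℝ v (eL a b k) = alpha a k.1 * inner ℝ u (sN a b k) := by
  have h1 := h _ (contDiff_eF a b k)
  rw [green_of_fderiv_eq u v (contDiff_eF a b k) (contDiff_sNF a b k).continuous
    (fderiv_eF_ex a b k)] at h1
  rw [sN, eL]
  linarith

theorem MatchingTraceY.inner_eL {a b : ℝ} (hb : 0 < b) {u v : L2 a b} (h : MatchingTraceY u v)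
    (k : ℕ × ℤ) : inner ℝ v (eL a b k) = -(beta b k.2 * inner ℝ u (eL a b (flip k))) := by
  have h1 := h _ (contDiff_eF a b k) fun x y => by simp only [eF, casY_periodic hb]
  rw [green_of_fderiv_eq u v (contDiff_eF a b k) (contDiff_eF a b (flip k)).continuous
    (fderiv_eF_ey a b k)] at h1
  rw [eL, eL]
  linarith

theorem fderiv_fderiv_comm {η : ℝ × ℝ → ℝ} (hη : ContDiff ℝ ∞ η) (p e e' : ℝ × ℝ) :
    fderiv ℝ (fun q => fderiv ℝ η q e) p e' = fderiv ℝ (fun q => fderiv ℝ η q e') p e := by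
  have hd : DifferentiableAt ℝ (fderiv ℝ η) p :=
    (hη.fderiv_right (m := ∞) (by simp)).differentiable (by simp) p
  have hs : IsSymmSndFDerivAt ℝ η p := hη.contDiffAt.isSymmSndFDerivAt (by
    rw [minSmoothness_of_isRCLikeNormedField]
    exact WithTop.coe_le_coe.2 (le_top : (2 : ℕ∞) ≤ ⊤))
  have h : ∀ v, fderiv ℝ (fun q => fderiv ℝ η q v) p = (fderiv ℝ (fderiv ℝ η) p).flip v := fun v => by
    rw [fderiv_clm_apply hd (differentiableAt_const v)]
    simp
  rw [h, h, ContinuousLinearMap.flip_apply, ContinuousLinearMap.flip_apply]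
  exact hs e' e

/-- The mixed derivative of an `H²` function is also the weak `x`-derivative of `w_y`. -/
theorem H2.weak_dyx {a b : ℝ} (w : H2 a b) : HasWeakDeriv ex w.dy w.dxy := by
  intro η hη hc hs
  have hηe : ∀ e : ℝ × ℝ, ContDiff ℝ ∞ fun q => fderiv ℝ η q e := fun e =>
    (hη.fderiv_right (m := ∞) (by simp)).clm_apply contDiff_const
  have hce : ∀ e : ℝ × ℝ, HasCompactSupport fun q => fderiv ℝ η q e := fun e => hc.fderiv_apply ℝ e
  have hse : ∀ e : ℝ × ℝ, tsupport (fun q => fderiv ℝ η q e) ⊆ Om a b := fun e =>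
    (tsupport_fderiv_apply_subset ℝ e).trans hs
  have h1 := w.weak_dxy η hη hc hs
  have h2 := w.weak_dx _ (hηe ey) (hce ey) (hse ey)
  have h3 := w.weak_dy _ (hηe ex) (hce ex) (hse ex)
  rw [green_eq_inner _ _ _ hη] at h1 ⊢
  rw [green_eq_inner _ _ _ (hηe ey)] at h2
  rw [green_eq_inner _ _ _ (hηe ex)] at h3
  have e : toL2 a b (continuous_fderiv_apply (hηe ey) ex) =
      toL2 a b (continuous_fderiv_apply (hηe ex) ey) := by
    have : (fun p => fderiv ℝ (fun q => fderiv ℝ η q ey) p ex) =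
        fun p => fderiv ℝ (fun q => fderiv ℝ η q ex) p ey := by
      ext p; exact fderiv_fderiv_comm hη p ey ex
    simp only [toL2, this]
  rw [e] at h2
  linarith

theorem H2.inner_dx {a b : ℝ} (ha : 0 < a) (hb : 0 < b) (w : H2 a b) (k : ℕ × ℤ) :
    inner ℝ w.dx (sN a b k) = -(alpha a k.1 * inner ℝ w.val (eL a b k)) :=
  w.weak_dx.inner_sN ha hb k

theorem inner_dy {a b : ℝ} (hb : 0 < b) {w : H2 a b} (hw : w ∈ V a b) (k : ℕ × ℤ) :
    inner ℝ w.dy (eL a b k) = -(beta b k.2 * inner ℝ w.val (eL a b (flip k))) :=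
  hw.2.1.inner_eL hb k

theorem inner_dxx {a b : ℝ} (ha : 0 < a) (hb : 0 < b) {w : H2 a b} (hw : w ∈ V a b) (k : ℕ × ℤ) :
    inner ℝ w.dxx (eL a b k) = -(alpha a k.1 ^ 2 * inner ℝ w.val (eL a b k)) := by
  rw [hw.1.inner_eL, w.inner_dx ha hb]; ring

theorem inner_dyy {a b : ℝ} (hb : 0 < b) {w : H2 a b} (hw : w ∈ V a b) (k : ℕ × ℤ) :
    inner ℝ w.dyy (eL a b k) = -(beta b k.2 ^ 2 * inner ℝ w.val (eL a b k)) := by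
  rw [hw.2.2.inner_eL hb, inner_dy hb hw, flip_flip]
  simp only [flip, beta_neg]; ring

/-- `V` states no periodicity for `w_x`, so the coefficient is read from `∂_x w_y`, where the sine
test functions need no boundary condition. -/
theorem inner_dxy {a b : ℝ} (ha : 0 < a) (hb : 0 < b) {w : H2 a b} (hw : w ∈ V a b) (k : ℕ × ℤ) :
    inner ℝ w.dxy (sN a b k) = alpha a k.1 * beta b k.2 * inner ℝ w.val (eL a b (flip k)) := by
  rw [w.weak_dyx.inner_sN ha hb, inner_dy hb hw]; ring

theorem eL_ext {a b : ℝ} (ha : 0 < a) (hb : 0 < b) {u v : L2 a b}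
    (h : ∀ k, inner ℝ u (eL a b k) = inner ℝ v (eL a b k)) : u = v := by
  have := (eB ha hb).hasSum_inner_mul_inner (u - v) (u - v)
  simp_rw [eB_apply, inner_sub_left, h, sub_self, zero_mul] at this
  rw [← sub_eq_zero, ← inner_self_eq_zero (𝕜 := ℝ), inner_sub_left]
  exact this.unique hasSum_zero

theorem sN_ext {a b : ℝ} (ha : 0 < a) (hb : 0 < b) {u v : L2 a b}
    (h : ∀ k, inner ℝ u (sN a b k) = inner ℝ v (sN a b k)) : u = v := by
  have := (sB ha hb).hasSum_inner_mul_inner (u - v) (u - v)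
  have h' : ∀ k : ℕ × ℤ, inner ℝ u (sL a b k) = inner ℝ v (sL a b k) := fun k => h (k.1 + 1, k.2)
  simp_rw [sB_apply, inner_sub_left, h', sub_self, zero_mul] at this
  rw [← sub_eq_zero, ← inner_self_eq_zero (𝕜 := ℝ), inner_sub_left]
  exact this.unique hasSum_zero

/-- An element of `V` is determined by its Fourier coefficients. -/
theorem ext_of_mem_V {a b : ℝ} (ha : 0 < a) (hb : 0 < b) {w z : H2 a b} (hw : w ∈ V a b)
    (hz : z ∈ V a b) (h : ∀ k, inner ℝ w.val (eL a b k) = inner ℝ z.val (eL a b k)) : w = z := by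
  apply H2.ext
  · exact eL_ext ha hb h
  · exact sN_ext ha hb fun k => by rw [w.inner_dx ha hb, z.inner_dx ha hb, h]
  · exact eL_ext ha hb fun k => by rw [inner_dy hb hw, inner_dy hb hz, h]
  · exact eL_ext ha hb fun k => by rw [inner_dxx ha hb hw, inner_dxx ha hb hz, h]
  · exact sN_ext ha hb fun k => by rw [inner_dxy ha hb hw, inner_dxy ha hb hz, h]
  · exact eL_ext ha hb fun k => by rw [inner_dyy hb hw, inner_dyy hb hz, h]

/-- The eigenvalues of `-Δ`. -/
noncomputable def mu (a b : ℝ) (k : ℕ × ℤ) : ℝ := alpha a k.1 ^ 2 + beta b k.2 ^ 2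

theorem inner_lap {a b : ℝ} (ha : 0 < a) (hb : 0 < b) {w : H2 a b} (hw : w ∈ V a b) (k : ℕ × ℤ) :
    inner ℝ (lap w) (eL a b k) = -(mu a b k * inner ℝ w.val (eL a b k)) := by
  rw [lap, inner_add_left, inner_dxx ha hb hw, inner_dyy hb hw, mu]; ring

/-! ### Construction of elements of `V` from coefficients -/

theorem integrableOn_Om_of_continuous {a b : ℝ} {f : ℝ × ℝ → ℝ} (hf : Continuous f) :
    IntegrableOn f (Om a b) :=
  (memLp_of_continuous (a := a) (b := b) hf).integrable one_le_two

theorem integral_fderiv_ex_eq_zero {a b : ℝ} (ha : 0 < a) {G : ℝ × ℝ → ℝ} (hG : ContDiff ℝ ∞ G)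
    (h : ∀ y, G (a, y) = G (-a, y)) : ∫ p in Om a b, fderiv ℝ G p ex = 0 := by
  have hi := integrableOn_Om_of_continuous (a := a) (b := b) (continuous_fderiv_apply hG ex)
  rw [IntegrableOn, volume_restrict_Om] at hi
  rw [volume_restrict_Om, integral_prod_symm _ hi]
  refine integral_eq_zero_of_ae (Filter.Eventually.of_forall fun y => ?_)
  have hd : ∀ x ∈ uIcc (-a) a, HasDerivAt (fun x => G (x, y)) (fderiv ℝ G (x, y) ex) x := by
    intro x _
    exact (hG.differentiable (by simp) (x, y)).hasFDerivAt.comp_hasDerivAt x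
      ((hasDerivAt_id x).prodMk (hasDerivAt_const x y))
  have := intervalIntegral.integral_eq_sub_of_hasDerivAt hd (Continuous.intervalIntegrable
    ((continuous_fderiv_apply hG ex).comp (by fun_prop)) _ _)
  rw [intervalIntegral.integral_of_le (by linarith), integral_Ioc_eq_integral_Ioo] at this
  simp only [Pi.zero_apply]
  rw [this, h y, sub_self]

theorem integral_fderiv_ey_eq_zero {a b : ℝ} (hb : 0 < b) {G : ℝ × ℝ → ℝ} (hG : ContDiff ℝ ∞ G)
    (h : ∀ x, G (x, b) = G (x, -b)) : ∫ p in Om a b, fderiv ℝ G p ey = 0 := by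
  have hi := integrableOn_Om_of_continuous (a := a) (b := b) (continuous_fderiv_apply hG ey)
  rw [IntegrableOn, volume_restrict_Om] at hi
  rw [volume_restrict_Om, integral_prod _ hi]
  refine integral_eq_zero_of_ae (Filter.Eventually.of_forall fun x => ?_)
  have hd : ∀ y ∈ uIcc (-b) b, HasDerivAt (fun y => G (x, y)) (fderiv ℝ G (x, y) ey) y := by
    intro y _
    exact (hG.differentiable (by simp) (x, y)).hasFDerivAt.comp_hasDerivAt y
      ((hasDerivAt_const y x).prodMk (hasDerivAt_id y))
  have := intervalIntegral.integral_eq_sub_of_hasDerivAt hd (Continuous.intervalIntegrable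
    ((continuous_fderiv_apply hG ey).comp (by fun_prop)) _ _)
  rw [intervalIntegral.integral_of_le (by linarith), integral_Ioc_eq_integral_Ioo] at this
  simp only [Pi.zero_apply]
  rw [this, h x, sub_self]

theorem green_toL2 {a b : ℝ} {e : ℝ × ℝ} {f f' η : ℝ × ℝ → ℝ} (hf : ContDiff ℝ ∞ f)
    (hf' : Continuous f') {c : ℝ} (hd : ∀ p, fderiv ℝ f p e = c * f' p) (hη : ContDiff ℝ ∞ η) :
    green e (toL2 a b hf.continuous) (c • toL2 a b hf') η =
      ∫ p in Om a b, fderiv ℝ (fun p => f p * η p) p e := by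
  refine integral_congr_ae ?_
  filter_upwards [coeFn_toL2 (a := a) (b := b) hf.continuous, coeFn_toL2 (a := a) (b := b) hf',
    Lp.coeFn_smul c (toL2 a b hf')] with p h1 h2 h3
  rw [h1, h3, Pi.smul_apply, h2, fderiv_fun_mul (hf.differentiable (by simp) p)
    (hη.differentiable (by simp) p)]
  simp [hd]
  ring

theorem green_smul {a b : ℝ} (e : ℝ × ℝ) (c : ℝ) (u v : L2 a b) {η : ℝ × ℝ → ℝ}
    (hη : ContDiff ℝ ∞ η) : green e (c • u) (c • v) η = c * green e u v η := by
  simp only [green_eq_inner _ _ _ hη, real_inner_smul_left]; ring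

/-- For a fixed test function `green` is continuous in both `L²` arguments, so weak derivatives and
trace conditions pass to convergent series. -/
theorem green_hasSum {a b : ℝ} {e : ℝ × ℝ} {ι : Type*} {u v : ι → L2 a b} {U W : L2 a b}
    (hu : HasSum u U) (hv : HasSum v W) {η : ℝ × ℝ → ℝ} (hη : ContDiff ℝ ∞ η)
    (h : ∀ k, green e (u k) (v k) η = 0) : green e U W η = 0 := by
  have h1 := (hu.mapL (innerSL ℝ (toL2 a b (continuous_fderiv_apply hη e)))).add
    (hv.mapL (innerSL ℝ (toL2 a b hη.continuous)))
  simp only [innerSL_apply_apply] at h1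
  rw [green_eq_inner _ _ _ hη, real_inner_comm, real_inner_comm _ W]
  refine h1.unique ?_
  convert hasSum_zero with k
  rw [← h k, green_eq_inner _ _ _ hη, real_inner_comm, real_inner_comm _ (v k)]

theorem green_eL_ex {a b : ℝ} (ha : 0 < a) (k : ℕ × ℤ) {η : ℝ × ℝ → ℝ} (hη : ContDiff ℝ ∞ η)
    (h : ∀ y, η (a, y) = 0 ∧ η (-a, y) = 0) : green ex (eL a b k) (-alpha a k.1 • sN a b k) η = 0 := by
  rw [eL, sN, green_toL2 (contDiff_eF a b k) _ (fderiv_eF_ex a b k) hη]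
  exact integral_fderiv_ex_eq_zero ha ((contDiff_eF a b k).mul hη) fun y => by simp [h y]

theorem green_sN_ex {a b : ℝ} (ha : 0 < a) (k : ℕ × ℤ) {η : ℝ × ℝ → ℝ} (hη : ContDiff ℝ ∞ η) :
    green ex (sN a b k) (alpha a k.1 • eL a b k) η = 0 := by
  rw [eL, sN, green_toL2 (contDiff_sNF a b k) _ (fderiv_sNF_ex a b k) hη]
  exact integral_fderiv_ex_eq_zero ha ((contDiff_sNF a b k).mul hη) fun y => by
    simp [sNF, sinX_neg, sinX_self ha]

theorem casY_self {b : ℝ} (hb : 0 < b) (n : ℤ) : casY b n b = casY b n (-b) := by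
  rw [← casY_periodic hb n (-b)]; congr 1; ring

theorem green_eL_ey {a b : ℝ} (hb : 0 < b) (k : ℕ × ℤ) {η : ℝ × ℝ → ℝ} (hη : ContDiff ℝ ∞ η)
    (h : ∀ x, η (x, b) = η (x, -b)) :
    green ey (eL a b k) (beta b k.2 • eL a b (flip k)) η = 0 := by
  rw [eL, eL, green_toL2 (contDiff_eF a b k) _ (fderiv_eF_ey a b k) hη]
  exact integral_fderiv_ey_eq_zero hb ((contDiff_eF a b k).mul hη) fun x => by
    simp [eF, casY_self hb, h x]

theorem green_sN_ey {a b : ℝ} (hb : 0 < b) (k : ℕ × ℤ) {η : ℝ × ℝ → ℝ} (hη : ContDiff ℝ ∞ η)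
    (h : ∀ x, η (x, b) = η (x, -b)) :
    green ey (sN a b k) (beta b k.2 • sN a b (flip k)) η = 0 := by
  rw [sN, sN, green_toL2 (contDiff_sNF a b k) _ (fderiv_sNF_ey a b k) hη]
  exact integral_fderiv_ey_eq_zero hb ((contDiff_sNF a b k).mul hη) fun x => by
    simp [sNF, casY_self hb, h x]

theorem eq_zero_on_sides {a b : ℝ} {η : ℝ × ℝ → ℝ} (h : tsupport η ⊆ Om a b) (y : ℝ) :
    η (a, y) = 0 ∧ η (-a, y) = 0 :=
  ⟨image_eq_zero_of_notMem_tsupport fun h' => lt_irrefl _ (mem_prod.1 (h h')).1.2,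
    image_eq_zero_of_notMem_tsupport fun h' => lt_irrefl _ (mem_prod.1 (h h')).1.1⟩

theorem eq_on_ends {a b : ℝ} {η : ℝ × ℝ → ℝ} (h : tsupport η ⊆ Om a b) (x : ℝ) :
    η (x, b) = η (x, -b) := by
  rw [image_eq_zero_of_notMem_tsupport fun h' => lt_irrefl _ (mem_prod.1 (h h')).2.2,
    image_eq_zero_of_notMem_tsupport fun h' => lt_irrefl _ (mem_prod.1 (h h')).2.1]

theorem flip_injective : Function.Injective flip :=
  Function.Involutive.injective flip_flip

theorem summable_smul_of_orthonormal {ι E : Type*} [NormedAddCommGroup E] [InnerProductSpace ℝ E]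
    [CompleteSpace E] {v : ι → E} (hv : Orthonormal ℝ v) {d : ι → ℝ}
    (hd : Summable fun k => d k ^ 2) : Summable fun k => d k • v k := by
  have h := hv.orthogonalFamily.summable_iff_norm_sq_summable (f := d)
  simpa using h.2 (by simpa using hd)

theorem shift_injective : Function.Injective fun k : ℕ × ℤ => (k.1 + 1, k.2) := by
  rintro ⟨m, n⟩ ⟨m', n'⟩ h
  simpa using h

theorem eq_zero_fst_of_notMem_range_shift {k : ℕ × ℤ}
    (hk : k ∉ range fun k : ℕ × ℤ => (k.1 + 1, k.2)) : k.1 = 0 := by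
  obtain ⟨m, n⟩ := k
  rcases m with _ | m
  · rfl
  · exact absurd ⟨(m, n), rfl⟩ hk

/-- The family `sN` vanishes at axial index `0` and is the orthonormal family `sL` after a shift by
one. -/
theorem summable_smul_sN {a b : ℝ} (ha : 0 < a) (hb : 0 < b) {d : ℕ × ℤ → ℝ}
    (hd : Summable fun k => d k ^ 2) : Summable fun k => d k • sN a b k := by
  refine (shift_injective.summable_iff fun k hk => ?_).1 ?_
  · have h0 := eq_zero_fst_of_notMem_range_shift hk
    have : sN a b k = 0 := by
      obtain ⟨m, n⟩ := k
      obtain rfl : m = 0 := h0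
      exact sN_zero a b n
    rw [this, smul_zero]
  · exact summable_smul_of_orthonormal (orthonormal_sL ha hb) (hd.comp_injective shift_injective)

theorem summable_smul_sN_flip {a b : ℝ} (ha : 0 < a) (hb : 0 < b) {d : ℕ × ℤ → ℝ}
    (hd : Summable fun k => d k ^ 2) : Summable fun k => d k • sN a b (flip k) := by
  have := (summable_smul_sN ha hb (d := d ∘ flip) (hd.comp_injective flip_injective)).comp_injective
    flip_injective
  simpa [Function.comp_def] using this

theorem mu_nonneg (a b : ℝ) (k : ℕ × ℤ) : 0 ≤ mu a b k := by unfold mu; positivity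

theorem summable_sq_of_le {a b : ℝ} {c : ℕ × ℤ → ℝ} (hc : Summable fun k => ((1 + mu a b k) * c k) ^ 2)
    {d : ℕ × ℤ → ℝ} (h : ∀ k, |d k| ≤ 1 + mu a b k) : Summable fun k => (c k * d k) ^ 2 := by
  refine Summable.of_nonneg_of_le (fun k => sq_nonneg _) (fun k => ?_) hc
  rw [mul_pow, mul_pow, mul_comm, ← sq_abs (d k)]
  exact mul_le_mul_of_nonneg_right (pow_le_pow_left₀ (abs_nonneg _) (h k) 2) (sq_nonneg _)

theorem abs_alpha_le {a b : ℝ} (k : ℕ × ℤ) : |-alpha a k.1| ≤ 1 + mu a b k := by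
  unfold mu; rw [abs_le]; constructor <;> nlinarith [sq_nonneg (alpha a k.1 - 1),
    sq_nonneg (alpha a k.1 + 1), sq_nonneg (beta b k.2)]

theorem abs_beta_le {a b : ℝ} (k : ℕ × ℤ) : |beta b k.2| ≤ 1 + mu a b k := by
  unfold mu; rw [abs_le]; constructor <;> nlinarith [sq_nonneg (beta b k.2 - 1),
    sq_nonneg (beta b k.2 + 1), sq_nonneg (alpha a k.1)]

/-- Differentiate term by term: every multiplier of order at most two is bounded by `1 + mu`, so all
six series converge in `L²`. Green's identities hold for each eigenfunction and survive the limit.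
-/
theorem exists_mem_V_hasSum {a b : ℝ} (ha : 0 < a) (hb : 0 < b) (c : ℕ × ℤ → ℝ)
    (hc : Summable fun k => ((1 + mu a b k) * c k) ^ 2) :
    ∃ w ∈ V a b, HasSum (fun k => c k • eL a b k) w.val :=
  have hval : Summable fun k => c k • eL a b k := by
    have := summable_smul_of_orthonormal (orthonormal_eL ha hb) (d := fun k => c k * 1)
      (summable_sq_of_le hc fun k => by simpa using mu_nonneg a b k)
    simpa using this
  have hdx : Summable fun k => c k • (-alpha a k.1 • sN a b k) := by
    simp_rw [smul_smul]
    exact summable_smul_sN ha hb (summable_sq_of_le hc abs_alpha_le)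
  have hdy : Summable fun k => c k • (beta b k.2 • eL a b (flip k)) := by
    simp_rw [smul_smul]
    exact summable_smul_of_orthonormal ((orthonormal_eL ha hb).comp flip flip_injective)
      (summable_sq_of_le hc abs_beta_le)
  have hdxx : Summable fun k => c k • (-alpha a k.1 • (alpha a k.1 • eL a b k)) := by
    simp_rw [smul_smul]
    refine summable_smul_of_orthonormal (orthonormal_eL ha hb) ?_
    refine summable_sq_of_le hc fun k => ?_
    rw [neg_mul, abs_neg, abs_mul_self, mu]
    nlinarith [sq_nonneg (beta b k.2)]
  have hdxy : Summable fun k => c k • (-alpha a k.1 • (beta b k.2 • sN a b (flip k))) := by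
    simp_rw [smul_smul]
    refine summable_smul_sN_flip ha hb ?_
    refine summable_sq_of_le hc fun k => ?_
    unfold mu; rw [abs_le]
    constructor <;> nlinarith [sq_nonneg (alpha a k.1 - beta b k.2),
      sq_nonneg (alpha a k.1 + beta b k.2)]
  have hdyy : Summable fun k =>
      c k • (beta b k.2 • (beta b (flip k).2 • eL a b (flip (flip k)))) := by
    simp_rw [smul_smul, flip_flip]
    refine summable_smul_of_orthonormal (orthonormal_eL ha hb) ?_
    refine summable_sq_of_le hc fun k => ?_
    simp only [flip, beta_neg]
    rw [mul_neg, abs_neg, abs_mul_self, mu]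
    nlinarith [sq_nonneg (alpha a k.1)]
  ⟨{  val := ∑' k, c k • eL a b k
      dx := ∑' k, c k • (-alpha a k.1 • sN a b k)
      dy := ∑' k, c k • (beta b k.2 • eL a b (flip k))
      dxx := ∑' k, c k • (-alpha a k.1 • (alpha a k.1 • eL a b k))
      dxy := ∑' k, c k • (-alpha a k.1 • (beta b k.2 • sN a b (flip k)))
      dyy := ∑' k, c k • (beta b k.2 • (beta b (flip k).2 • eL a b (flip (flip k))))
      weak_dx := fun η hη _ hs => green_hasSum hval.hasSum hdx.hasSum hη fun k => by
        rw [green_smul _ _ _ _ hη, green_eL_ex ha k hη (eq_zero_on_sides hs), mul_zero]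
      weak_dy := fun η hη _ hs => green_hasSum hval.hasSum hdy.hasSum hη fun k => by
        rw [green_smul _ _ _ _ hη, green_eL_ey hb k hη (eq_on_ends hs), mul_zero]
      weak_dxx := fun η hη _ hs => green_hasSum hdx.hasSum hdxx.hasSum hη fun k => by
        rw [green_smul _ _ _ _ hη, green_smul _ _ _ _ hη, green_sN_ex ha k hη, mul_zero, mul_zero]
      weak_dxy := fun η hη _ hs => green_hasSum hdx.hasSum hdxy.hasSum hη fun k => by
        rw [green_smul _ _ _ _ hη, green_smul _ _ _ _ hη, green_sN_ey hb k hη (eq_on_ends hs),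
          mul_zero, mul_zero]
      weak_dyy := fun η hη _ hs => green_hasSum hdy.hasSum hdyy.hasSum hη fun k => by
        rw [green_smul _ _ _ _ hη, green_smul _ _ _ _ hη, green_eL_ey hb (flip k) hη (eq_on_ends hs),
          mul_zero, mul_zero] },
    ⟨fun η hη => green_hasSum hdx.hasSum hdxx.hasSum hη fun k => by
        rw [green_smul _ _ _ _ hη, green_smul _ _ _ _ hη, green_sN_ex ha k hη, mul_zero, mul_zero],
      fun η hη hp => green_hasSum hval.hasSum hdy.hasSum hη fun k => by
        rw [green_smul _ _ _ _ hη, green_eL_ey hb k hη (fun x => by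
          rw [← hp x (-b)]; congr 2; ring), mul_zero],
      fun η hη hp => green_hasSum hdy.hasSum hdyy.hasSum hη fun k => by
        rw [green_smul _ _ _ _ hη, green_smul _ _ _ _ hη, green_eL_ey hb (flip k) hη (fun x => by
          rw [← hp x (-b)]; congr 2; ring), mul_zero, mul_zero]⟩,
    hval.hasSum⟩

theorem exists_mem_V_of_coef {a b : ℝ} (ha : 0 < a) (hb : 0 < b) (c : ℕ × ℤ → ℝ)
    (hc : Summable fun k => ((1 + mu a b k) * c k) ^ 2) :
    ∃ w ∈ V a b, ∀ k, inner ℝ w.val (eL a b k) = c k := by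
  obtain ⟨w, hw, hs⟩ := exists_mem_V_hasSum ha hb c hc
  refine ⟨w, hw, fun k => ?_⟩
  have h1 := hs.mapL (innerSL ℝ (eL a b k))
  simp only [innerSL_apply_apply, real_inner_smul_right] at h1
  rw [real_inner_comm]
  refine h1.unique ?_
  have h2 := orthonormal_iff_ite.1 (orthonormal_eL ha hb) k
  simp_rw [h2, mul_ite, mul_one, mul_zero]
  have e : (fun j => if k = j then c j else 0) = fun j => if j = k then c k else 0 := by
    ext j
    rcases eq_or_ne k j with rfl | h
    · simp
    · simp [h, h.symm]
  rw [e]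
  exact hasSum_ite_eq k (c k)

/-! ### Parseval identities and bounds on second derivatives -/

theorem hasSum_inner_eL {a b : ℝ} (ha : 0 < a) (hb : 0 < b) (u v : L2 a b) :
    HasSum (fun k => inner ℝ u (eL a b k) * inner ℝ v (eL a b k)) (inner ℝ u v) := by
  have := (eB ha hb).hasSum_inner_mul_inner u v
  simp_rw [eB_apply] at this
  simpa only [real_inner_comm v] using this

theorem hasSum_inner_sN {a b : ℝ} (ha : 0 < a) (hb : 0 < b) (u v : L2 a b) :
    HasSum (fun k => inner ℝ u (sN a b k) * inner ℝ v (sN a b k)) (inner ℝ u v) := by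
  have := (sB ha hb).hasSum_inner_mul_inner u v
  simp_rw [sB_apply, fun k => real_inner_comm v (sL a b k)] at this
  refine (shift_injective.hasSum_iff fun k hk => ?_).1 this
  obtain ⟨m, n⟩ := k
  obtain rfl : m = 0 := eq_zero_fst_of_notMem_range_shift hk
  rw [sN_zero, inner_zero_right, zero_mul]

theorem hasSum_of_eq {ι : Type*} {f g : ι → ℝ} {s : ℝ} (h : HasSum g s) (e : ∀ k, f k = g k) :
    HasSum f s := by
  rwa [funext e]

section V

variable {a b : ℝ} {w z : H2 a b}

theorem hasSum_lap (ha : 0 < a) (hb : 0 < b) (hw : w ∈ V a b) (hz : z ∈ V a b) :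
    HasSum (fun k => mu a b k ^ 2 * (inner ℝ w.val (eL a b k) * inner ℝ z.val (eL a b k)))
      (inner ℝ (lap w) (lap z)) := by
  convert hasSum_inner_eL ha hb (lap w) (lap z) using 2 with k
  rw [inner_lap ha hb hw, inner_lap ha hb hz]; ring

/-- Integration by parts read on coefficients: one side is expanded in cosines, the other in sines,
and the terms agree up to sign. This links the shortening to the equation of `φ₁`. -/
theorem inner_dxx_val (ha : 0 < a) (hb : 0 < b) (hw : w ∈ V a b) :
    inner ℝ w.dxx w.val = -inner ℝ w.dx w.dx := by
  refine (hasSum_inner_eL ha hb w.dxx w.val).unique ?_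
  refine hasSum_of_eq (hasSum_inner_sN ha hb w.dx w.dx).neg fun k => ?_
  rw [inner_dxx ha hb hw, w.inner_dx ha hb]; ring

theorem hasSum_dxy (ha : 0 < a) (hb : 0 < b) (hw : w ∈ V a b) :
    HasSum (fun k => alpha a k.1 ^ 2 * beta b k.2 ^ 2 * inner ℝ w.val (eL a b k) ^ 2)
      (inner ℝ w.dxy w.dxy) := by
  have h := (Function.Involutive.toPerm flip flip_flip).hasSum_iff.2
    (hasSum_inner_sN ha hb w.dxy w.dxy)
  refine hasSum_of_eq h fun k => ?_
  change _ = inner ℝ w.dxy (sN a b (flip k)) * inner ℝ w.dxy (sN a b (flip k))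
  rw [inner_dxy ha hb hw, flip_flip]
  simp only [flip, beta_neg]; ring

/-- Both sides are the series of `α² β² c²`. This is the compatibility condition for a right-hand
side `[w,w]`. -/
theorem inner_dxx_dyy (ha : 0 < a) (hb : 0 < b) (hw : w ∈ V a b) :
    inner ℝ w.dxx w.dyy = inner ℝ w.dxy w.dxy := by
  refine (hasSum_inner_eL ha hb w.dxx w.dyy).unique ?_
  convert hasSum_dxy ha hb hw using 2 with k
  rw [inner_dxx ha hb hw, inner_dyy hb hw]; ring

/-- Termwise `α⁴ ≤ (α² + β²)²`; the next two lemmas use `β⁴` and `α² β²` in the same way. -/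
theorem inner_dxx_le (ha : 0 < a) (hb : 0 < b) (hw : w ∈ V a b) :
    inner ℝ w.dxx w.dxx ≤ inner ℝ (lap w) (lap w) := by
  refine hasSum_le (fun k => ?_) (hasSum_inner_eL ha hb w.dxx w.dxx) (hasSum_lap ha hb hw hw)
  rw [inner_dxx ha hb hw, mu]
  have : 0 ≤ (2 * alpha a k.1 ^ 2 * beta b k.2 ^ 2 + beta b k.2 ^ 4) * inner ℝ w.val (eL a b k) ^ 2 := by
    positivity
  linarith

theorem inner_dyy_le (ha : 0 < a) (hb : 0 < b) (hw : w ∈ V a b) :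
    inner ℝ w.dyy w.dyy ≤ inner ℝ (lap w) (lap w) := by
  refine hasSum_le (fun k => ?_) (hasSum_inner_eL ha hb w.dyy w.dyy) (hasSum_lap ha hb hw hw)
  rw [inner_dyy hb hw, mu]
  have : 0 ≤ (2 * alpha a k.1 ^ 2 * beta b k.2 ^ 2 + alpha a k.1 ^ 4) * inner ℝ w.val (eL a b k) ^ 2 := by
    positivity
  linarith

theorem inner_dxy_le (ha : 0 < a) (hb : 0 < b) (hw : w ∈ V a b) :
    inner ℝ w.dxy w.dxy ≤ inner ℝ (lap w) (lap w) := by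
  refine hasSum_le (fun k => ?_) (hasSum_dxy ha hb hw) (hasSum_lap ha hb hw hw)
  rw [mu]
  have : 0 ≤ (alpha a k.1 ^ 4 + alpha a k.1 ^ 2 * beta b k.2 ^ 2 + beta b k.2 ^ 4) *
      inner ℝ w.val (eL a b k) ^ 2 := by positivity
  linarith

end V

/-! ### Spectral gap, absolute convergence and the sup bound -/

theorem exists_gap {a b : ℝ} (ha : 0 < a) (hb : 0 < b) : ∃ κ > 0, κ ≤ 1 ∧
    (∀ k ≠ 0, κ ≤ mu a b k) ∧
    ∀ k : ℕ × ℤ, κ * (1 + (k.1 : ℝ) ^ 2 + (k.2 : ℝ) ^ 2) ≤ 1 + mu a b k := by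
  have hα : 0 < (Real.pi / (2 * a)) ^ 2 := by have := Real.pi_pos; positivity
  have hβ : 0 < (Real.pi / b) ^ 2 := by have := Real.pi_pos; positivity
  set κ := min 1 (min ((Real.pi / (2 * a)) ^ 2) ((Real.pi / b) ^ 2)) with hκ
  have h1 : κ ≤ 1 := min_le_left _ _
  have h2 : κ ≤ (Real.pi / (2 * a)) ^ 2 := (min_le_right _ _).trans (min_le_left _ _)
  have h3 : κ ≤ (Real.pi / b) ^ 2 := (min_le_right _ _).trans (min_le_right _ _)
  have hκ0 : 0 < κ := lt_min one_pos (lt_min hα hβ)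
  have hmu : ∀ k : ℕ × ℤ, κ * ((k.1 : ℝ) ^ 2 + (k.2 : ℝ) ^ 2) ≤ mu a b k := by
    intro k
    have e : mu a b k = (Real.pi / (2 * a)) ^ 2 * (k.1 : ℝ) ^ 2 + (Real.pi / b) ^ 2 * (k.2 : ℝ) ^ 2 := by
      unfold mu alpha beta; ring
    rw [e, mul_add]
    exact add_le_add (mul_le_mul_of_nonneg_right h2 (sq_nonneg _))
      (mul_le_mul_of_nonneg_right h3 (sq_nonneg _))
  refine ⟨κ, hκ0, h1, fun k hk => ?_, fun k => by linarith [hmu k]⟩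
  have h : (1 : ℝ) ≤ (k.1 : ℝ) ^ 2 + (k.2 : ℝ) ^ 2 := by
    have : (1 : ℤ) ≤ (k.1 : ℤ) ^ 2 + k.2 ^ 2 := by
      obtain ⟨m, n⟩ := k
      by_contra! h0
      have hm : (m : ℤ) = 0 := by nlinarith [sq_nonneg (m : ℤ), sq_nonneg n]
      have hn : n = 0 := by nlinarith [sq_nonneg (m : ℤ), sq_nonneg n]
      exact hk (by ext <;> simp_all)
    exact_mod_cast this
  exact (le_mul_of_one_le_right hκ0.le h).trans (hmu k)

theorem summable_nat_one_add_sq : Summable fun m : ℕ => (1 + (m : ℝ) ^ 2)⁻¹ := by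
  rw [← summable_nat_add_iff 1]
  refine Summable.of_nonneg_of_le (fun m => by positivity) (fun m => ?_)
    ((summable_nat_add_iff 1).2 (Real.summable_nat_pow_inv.2 one_lt_two))
  exact inv_anti₀ (by positivity) (by linarith)

theorem summable_int_one_add_sq : Summable fun n : ℤ => (1 + (n : ℝ) ^ 2)⁻¹ := by
  refine Summable.of_nat_of_neg ?_ ?_ <;> simpa using summable_nat_one_add_sq

/-- The bound `(1 + m² + n²)² ≥ (1 + m²)(1 + n²)` splits the double series into two convergent ones.
This is the point at which dimension two enters. -/
theorem summable_one_add_mu {a b : ℝ} (ha : 0 < a) (hb : 0 < b) :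
    Summable fun k : ℕ × ℤ => ((1 + mu a b k)⁻¹) ^ 2 := by
  obtain ⟨κ, hκ, -, -, h⟩ := exists_gap ha hb
  have hs := (summable_nat_one_add_sq.mul_of_nonneg summable_int_one_add_sq
    (fun m => by positivity) (fun n => by positivity)).mul_left (κ⁻¹ ^ 2)
  refine Summable.of_nonneg_of_le (fun k => by positivity) (fun k => ?_) hs
  rw [← mul_inv, inv_pow, inv_pow, ← mul_inv]
  refine inv_anti₀ (by positivity) ?_
  calc κ ^ 2 * ((1 + (k.1 : ℝ) ^ 2) * (1 + (k.2 : ℝ) ^ 2))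
      ≤ κ ^ 2 * (1 + (k.1 : ℝ) ^ 2 + (k.2 : ℝ) ^ 2) ^ 2 := by
        refine mul_le_mul_of_nonneg_left ?_ (sq_nonneg _)
        nlinarith [sq_nonneg (k.1 : ℝ), sq_nonneg (k.2 : ℝ),
          mul_nonneg (sq_nonneg (k.1 : ℝ)) (sq_nonneg (k.2 : ℝ))]
    _ = (κ * (1 + (k.1 : ℝ) ^ 2 + (k.2 : ℝ) ^ 2)) ^ 2 := by ring
    _ ≤ (1 + mu a b k) ^ 2 := pow_le_pow_left₀ (by positivity) (h k) 2

/-- The Cauchy-Schwarz inequality for series. -/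
theorem summable_abs_mul_and_tsum_le {ι : Type*} {f g : ι → ℝ} (hf : Summable fun k => f k ^ 2)
    (hg : Summable fun k => g k ^ 2) : (Summable fun k => |f k * g k|) ∧
      ∑' k, |f k * g k| ≤ Real.sqrt (∑' k, f k ^ 2) * Real.sqrt (∑' k, g k ^ 2) := by
  have hfin : ∀ s : Finset ι, ∑ k ∈ s, |f k * g k| ≤
      Real.sqrt (∑' k, f k ^ 2) * Real.sqrt (∑' k, g k ^ 2) := by
    intro s
    rw [← Real.sqrt_mul (tsum_nonneg fun k => sq_nonneg _)]
    refine Real.le_sqrt_of_sq_le ?_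
    have := Finset.sum_mul_sq_le_sq_mul_sq s (fun k => |f k|) (fun k => |g k|)
    simp only [sq_abs, ← abs_mul] at this
    refine this.trans (mul_le_mul (hf.sum_le_tsum _ fun k _ => sq_nonneg _)
      (hg.sum_le_tsum _ fun k _ => sq_nonneg _) (Finset.sum_nonneg fun k _ => sq_nonneg _)
      (tsum_nonneg fun k => sq_nonneg _))
  exact ⟨summable_of_sum_le (fun k => abs_nonneg _) hfin,
    Real.tsum_le_of_sum_le (fun k => abs_nonneg _) hfin⟩

theorem exists_bound_eF (a b : ℝ) : ∃ M, 0 ≤ M ∧ ∀ k p, |eF a b k p| ≤ M := by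
  refine ⟨(|nrm a b 0| + |nrm a b 1|) * 2, by positivity, fun k p => ?_⟩
  have hn : |nrm a b k.1| ≤ |nrm a b 0| + |nrm a b 1| := by
    by_cases h : k.1 = 0
    · rw [h]; linarith [abs_nonneg (nrm a b 1)]
    · have : nrm a b k.1 = nrm a b 1 := by simp [nrm, h]
      rw [this]; linarith [abs_nonneg (nrm a b 0)]
  rw [eF, abs_mul, abs_mul]
  refine mul_le_mul hn ?_ (by positivity) (by positivity)
  have := mul_le_mul (abs_cosX_le a k.1 p.1) (abs_casY_le b k.2 p.2) (abs_nonneg _) zero_le_one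
  linarith

/-- Uniformly bounded eigenfunctions and absolutely summable coefficients permit termwise
integration against a function that is only in `L¹`. -/
theorem hasSum_integral_mul_tsum {a b : ℝ} {f : ℝ × ℝ → ℝ} (hf : IntegrableOn f (Om a b))
    {c : ℕ × ℤ → ℝ} (hc : Summable fun k => |c k|) :
    HasSum (fun k => c k * ∫ p in Om a b, f p * eF a b k p)
      (∫ p in Om a b, f p * ∑' k, c k * eF a b k p) := by
  obtain ⟨M, hM0, hM⟩ := exists_bound_eF a b
  have hi : ∀ k, IntegrableOn (fun p => f p * eF a b k p) (Om a b) := fun k =>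
    integrable_mul_of_continuous hf (contDiff_eF a b k).continuous
  have h := hasSum_integral_of_summable_integral_norm (F := fun k p => c k * (f p * eF a b k p))
    (fun k => (hi k).const_mul (c k)) (by
      refine Summable.of_nonneg_of_le (fun k => integral_nonneg fun p => norm_nonneg _) (fun k => ?_)
        (hc.mul_right (M * ∫ p in Om a b, |f p|))
      simp_rw [norm_mul, Real.norm_eq_abs]
      rw [integral_const_mul, ← integral_const_mul M]
      refine mul_le_mul_of_nonneg_left (integral_mono ?_ (hf.abs.const_mul M) fun p => ?_) (abs_nonneg _)
      · simpa only [abs_mul] using (hi k).abs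
      · simp only
        rw [mul_comm]
        exact mul_le_mul_of_nonneg_right (hM k p) (abs_nonneg _))
  simp_rw [integral_const_mul] at h
  have e : ∀ p, f p * ∑' k, c k * eF a b k p = ∑' k, c k * (f p * eF a b k p) := fun p => by
    simp_rw [← tsum_mul_left, mul_left_comm]
  simp_rw [e]
  exact h

/-- A function with absolutely summable Fourier coefficients is the sum of its Fourier series. -/
theorem ae_eq_tsum {a b : ℝ} (ha : 0 < a) (hb : 0 < b) (u : L2 a b)
    (hu : Summable fun k => |inner ℝ u (eL a b k)|) :
    u =ᵐ[volume.restrict (Om a b)] fun p => ∑' k, inner ℝ u (eL a b k) * eF a b k p := by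
  obtain ⟨M, hM0, hM⟩ := exists_bound_eF a b
  set S : ℝ × ℝ → ℝ := fun p => ∑' k, inner ℝ u (eL a b k) * eF a b k p with hS
  have hSc : Continuous S := by
    refine continuous_tsum (fun k => continuous_const.mul (contDiff_eF a b k).continuous)
      (hu.mul_right M) fun k p => ?_
    rw [norm_mul]
    exact mul_le_mul_of_nonneg_left (hM k p) (norm_nonneg _)
  have hz := eF_complete ha hb (h := fun p => u p - S p)
    ((integrable_L2 u).sub (integrableOn_Om_of_continuous hSc)) fun j => by
      simp_rw [sub_mul]
      rw [integral_sub (integrable_mul_of_continuous (integrable_L2 u) (contDiff_eF a b j).continuous)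
        (by exact integrableOn_Om_of_continuous (hSc.mul (contDiff_eF a b j).continuous)), ← inner_eL,
        sub_eq_zero]
      have h := hasSum_integral_mul_tsum (integrableOn_Om_of_continuous (a := a) (b := b)
        (contDiff_eF a b j).continuous) hu
      have e : ∀ k, ∫ p in Om a b, eF a b j p * eF a b k p = if k = j then 1 else 0 := by
        intro k
        have h2 := orthonormal_iff_ite.1 (orthonormal_eL ha hb) k j
        rw [← h2, real_inner_comm, inner_eL]
        refine integral_congr_ae ?_
        filter_upwards [coeFn_toL2 (a := a) (b := b) (contDiff_eF a b j).continuous] with p hp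
        rw [eL, hp]
      simp_rw [e, mul_ite, mul_one, mul_zero] at h
      have h3 := h.unique (by
        have := hasSum_ite_eq j (inner ℝ u (eL a b j))
        convert this using 2 with k
        split_ifs with hk
        · rw [hk]
        · rfl)
      rw [← h3]
      simp_rw [mul_comm (S _)]
      rfl
  filter_upwards [hz] with p hp
  exact sub_eq_zero.1 hp

/-- A Parseval identity with `f` only in `L¹`, as required for the bracket. -/
theorem hasSum_integral_mul {a b : ℝ} (ha : 0 < a) (hb : 0 < b) {f : ℝ × ℝ → ℝ}
    (hf : IntegrableOn f (Om a b)) (u : L2 a b) (hu : Summable fun k => |inner ℝ u (eL a b k)|) :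
    HasSum (fun k => inner ℝ u (eL a b k) * ∫ p in Om a b, f p * eF a b k p)
      (∫ p in Om a b, f p * u p) := by
  have e : ∫ p in Om a b, f p * u p =
      ∫ p in Om a b, f p * ∑' k, inner ℝ u (eL a b k) * eF a b k p := by
    refine integral_congr_ae ?_
    filter_upwards [ae_eq_tsum ha hb u hu] with p hp
    rw [hp]
  rw [e]
  exact hasSum_integral_mul_tsum hf hu

/-- Cauchy-Schwarz between `(1 + mu)⁻¹` and `(1 + mu) c`, the latter being the coefficients of `w -
Δw`. -/
theorem summable_abs_coef {a b : ℝ} (ha : 0 < a) (hb : 0 < b) {w : H2 a b} (hw : w ∈ V a b) :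
    Summable fun k => |inner ℝ w.val (eL a b k)| := by
  have h := (hasSum_inner_eL ha hb (w.val - lap w) (w.val - lap w)).summable
  have e : ∀ k, inner ℝ (w.val - lap w) (eL a b k) = (1 + mu a b k) * inner ℝ w.val (eL a b k) := by
    intro k; rw [inner_sub_left, inner_lap ha hb hw]; ring
  simp_rw [e, ← sq] at h
  have := (summable_abs_mul_and_tsum_le (summable_one_add_mu ha hb) h).1
  refine this.congr fun k => ?_
  rw [inv_mul_cancel_left₀ (by linarith [mu_nonneg a b k])]

theorem eF_zero (a b : ℝ) (p : ℝ × ℝ) : eF a b 0 p = nrm a b 0 := by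
  simp [eF, cosX, casY, alpha, beta]

theorem mu_zero (a b : ℝ) : mu a b 0 = 0 := by simp [mu, alpha, beta]

theorem inner_eL_zero (a b : ℝ) {w : H2 a b} (hw : w ∈ X a b) : inner ℝ w.val (eL a b 0) = 0 := by
  rw [inner_eL]
  simp_rw [eF_zero]
  rw [integral_mul_const, hw.2, zero_mul]

theorem mem_X_of_coef {a b : ℝ} (ha : 0 < a) (hb : 0 < b) {w : H2 a b} (hw : w ∈ V a b)
    (h : inner ℝ w.val (eL a b 0) = 0) : w ∈ X a b := by
  refine ⟨hw, ?_⟩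
  rw [inner_eL] at h
  simp_rw [eF_zero] at h
  rw [integral_mul_const] at h
  exact (mul_eq_zero.1 h).resolve_right (nrm_ne_zero ha hb 0)

theorem one_add_mu_le {a b κ : ℝ} (hκ : 0 < κ) {k : ℕ × ℤ} (h : κ ≤ mu a b k) :
    1 + mu a b k ≤ (1 + κ⁻¹) * mu a b k := by
  have : 1 ≤ κ⁻¹ * mu a b k := by
    rw [← inv_mul_cancel₀ hκ.ne']
    exact mul_le_mul_of_nonneg_left h (inv_nonneg.2 hκ.le)
  linarith

/-- The Sobolev embedding of `X` into the bounded functions. -/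
theorem exists_sup_bound {a b : ℝ} (ha : 0 < a) (hb : 0 < b) : ∃ K, 0 ≤ K ∧ ∀ w ∈ X a b,
    ∀ᵐ p ∂volume.restrict (Om a b), |w.val p| ≤ K * Real.sqrt (inner ℝ (lap w) (lap w)) := by
  obtain ⟨κ, hκ, -, hgap, -⟩ := exists_gap ha hb
  obtain ⟨M, hM0, hM⟩ := exists_bound_eF a b
  refine ⟨M * (Real.sqrt (∑' k : ℕ × ℤ, ((1 + mu a b k)⁻¹) ^ 2) * (1 + κ⁻¹)), by positivity,
    fun w hw => ?_⟩
  have hl := hasSum_lap ha hb hw.1 hw.1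
  -- The mode `0` is absent from `X`; on the others the gap compares `1 + mu` with `mu`.
  have hle : ∀ k, ((1 + mu a b k) * inner ℝ w.val (eL a b k)) ^ 2 ≤
      (1 + κ⁻¹) ^ 2 * (mu a b k ^ 2 * (inner ℝ w.val (eL a b k) * inner ℝ w.val (eL a b k))) := by
    intro k
    rcases eq_or_ne k 0 with rfl | hk
    · simp [inner_eL_zero a b hw]
    · have h1 := pow_le_pow_left₀ (by linarith [mu_nonneg a b k]) (one_add_mu_le hκ (hgap k hk)) 2
      calc ((1 + mu a b k) * inner ℝ w.val (eL a b k)) ^ 2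
          = (1 + mu a b k) ^ 2 * inner ℝ w.val (eL a b k) ^ 2 := mul_pow _ _ _
        _ ≤ ((1 + κ⁻¹) * mu a b k) ^ 2 * inner ℝ w.val (eL a b k) ^ 2 :=
          mul_le_mul_of_nonneg_right h1 (sq_nonneg _)
        _ = _ := by ring
  have hs := Summable.of_nonneg_of_le (fun k => sq_nonneg _) hle (hl.summable.mul_left _)
  have hsum := (summable_abs_mul_and_tsum_le (summable_one_add_mu ha hb) hs).2
  have hcancel : ∀ k, (1 + mu a b k)⁻¹ * ((1 + mu a b k) * inner ℝ w.val (eL a b k)) =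
      inner ℝ w.val (eL a b k) := fun k =>
    inv_mul_cancel_left₀ (by linarith [mu_nonneg a b k]) _
  simp_rw [hcancel] at hsum
  have hsq : Real.sqrt (∑' k, ((1 + mu a b k) * inner ℝ w.val (eL a b k)) ^ 2) ≤
      (1 + κ⁻¹) * Real.sqrt (inner ℝ (lap w) (lap w)) := by
    rw [← Real.sqrt_sq (by positivity : 0 ≤ 1 + κ⁻¹), ← Real.sqrt_mul (sq_nonneg _)]
    refine Real.sqrt_le_sqrt ?_
    rw [← hl.tsum_eq, ← tsum_mul_left]
    exact hs.tsum_le_tsum hle (hl.summable.mul_left _)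
  have habs := summable_abs_coef ha hb hw.1
  filter_upwards [ae_eq_tsum ha hb w.val habs] with p hp
  rw [hp]
  have hterm : ∀ k, ‖inner ℝ w.val (eL a b k) * eF a b k p‖ ≤ |inner ℝ w.val (eL a b k)| * M := by
    intro k
    rw [norm_mul]
    exact mul_le_mul_of_nonneg_left (hM k p) (norm_nonneg _)
  have h1 := tsum_of_norm_bounded (habs.mul_right M).hasSum hterm
  rw [tsum_mul_right] at h1
  refine h1.trans ?_
  rw [mul_comm, mul_assoc]
  refine mul_le_mul_of_nonneg_left (hsum.trans ?_) hM0
  rw [mul_assoc]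
  exact mul_le_mul_of_nonneg_left hsq (Real.sqrt_nonneg _)

/-! ### Weak solutions of the biharmonic problem -/

theorem IsSol.inner_lap_eq {a b : ℝ} {f : ℝ × ℝ → ℝ} {φ : H2 a b} (h : IsSol f φ) {ψ : H2 a b}
    (hψ : ψ ∈ V a b) : inner ℝ (lap φ) (lap ψ) = ∫ p in Om a b, f p * ψ.val p := by
  rw [inner_eq, h.2 ψ hψ]

/-- Single eigenfunctions as elements of `V`. -/
theorem exists_eigenfunction {a b : ℝ} (ha : 0 < a) (hb : 0 < b) (k : ℕ × ℤ) (t : ℝ) :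
    ∃ w ∈ V a b, w.val = t • eL a b k ∧ w.dxx = -(alpha a k.1 ^ 2 * t) • eL a b k ∧
      lap w = -(mu a b k * t) • eL a b k := by
  obtain ⟨w, hw, hc⟩ := exists_mem_V_of_coef ha hb (fun j => if j = k then t else 0) (by
    refine (hasSum_ite_eq k (((1 + mu a b k) * t) ^ 2)).summable.congr fun j => ?_
    split_ifs with h
    · rw [h]
    · simp)
  have ho := orthonormal_iff_ite.1 (orthonormal_eL ha hb) k
  refine ⟨w, hw, eL_ext ha hb fun j => ?_, eL_ext ha hb fun j => ?_, eL_ext ha hb fun j => ?_⟩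
  · rw [hc, real_inner_smul_left, ho]
    rcases eq_or_ne j k with rfl | h
    · simp
    · simp [h, h.symm]
  · rw [inner_dxx ha hb hw, hc, real_inner_smul_left, ho]
    rcases eq_or_ne j k with rfl | h
    · simp
    · simp [h, h.symm]
  · rw [inner_lap ha hb hw, hc, real_inner_smul_left, ho]
    rcases eq_or_ne j k with rfl | h
    · simp
    · simp [h, h.symm]

theorem mu_pos {a b : ℝ} (ha : 0 < a) (hb : 0 < b) {k : ℕ × ℤ} (hk : k ≠ 0) : 0 < mu a b k := by
  obtain ⟨κ, hκ, -, hgap, -⟩ := exists_gap ha hb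
  exact hκ.trans_le (hgap k hk)

/-- The Fourier coefficients of a weak solution. -/
theorem IsSol.coef {a b : ℝ} (ha : 0 < a) (hb : 0 < b) {f : ℝ × ℝ → ℝ} {φ : H2 a b}
    (h : IsSol f φ) (k : ℕ × ℤ) :
    inner ℝ φ.val (eL a b k) = (∫ p in Om a b, f p * eF a b k p) / mu a b k ^ 2 := by
  rcases eq_or_ne k 0 with rfl | hk
  -- At `k = 0` the left side vanishes by normalization and the right side because division by zero
  -- gives zero.
  · simp [inner_eL_zero a b h.1, mu_zero]
  · obtain ⟨ψ, hψ, hv, -, hl⟩ := exists_eigenfunction ha hb k 1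
    have h1 := h.inner_lap_eq hψ
    have h2 : ∫ p in Om a b, f p * ψ.val p = ∫ p in Om a b, f p * eF a b k p := by
      refine integral_congr_ae ?_
      rw [hv, one_smul]
      filter_upwards [coeFn_toL2 (a := a) (b := b) (contDiff_eF a b k).continuous] with p hp
      rw [eL, hp]
    have hm := (mu_pos ha hb hk).ne'
    rw [← h2, ← h1, hl, real_inner_smul_right, inner_lap ha hb h.1.1]
    field_simp

/-- The coefficients must be `d k / mu²`, which gives uniqueness. For existence, `d` is bounded
because `f` is in `L¹`, so `(1 + mu) d / mu²` is of the order of `(1 + mu)⁻¹`, hence square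
summable. Mean zero of `f` makes the equation hold for tests with a constant component. -/
theorem existsUnique_isSol {a b : ℝ} (ha : 0 < a) (hb : 0 < b) {f : ℝ × ℝ → ℝ}
    (hf : IntegrableOn f (Om a b)) (h0 : ∫ p in Om a b, f p = 0) :
    ∃! φ : H2 a b, IsSol f φ := by
  obtain ⟨κ, hκ, -, hgap, -⟩ := exists_gap ha hb
  obtain ⟨M, hM0, hM⟩ := exists_bound_eF a b
  set d : ℕ × ℤ → ℝ := fun k => ∫ p in Om a b, f p * eF a b k p with hd
  have hd0 : d 0 = 0 := by
    simp only [hd, eF_zero]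
    rw [integral_mul_const, h0, zero_mul]
  have hdb : ∀ k, |d k| ≤ M * ∫ p in Om a b, |f p| := by
    intro k
    have hn : |d k| ≤ _ := norm_integral_le_integral_norm (μ := volume.restrict (Om a b))
      fun p => f p * eF a b k p
    refine hn.trans ?_
    rw [← integral_const_mul]
    refine integral_mono (integrable_mul_of_continuous hf (contDiff_eF a b k).continuous).norm
      (hf.abs.const_mul M) fun p => ?_
    simp only [norm_mul, Real.norm_eq_abs]
    rw [mul_comm]
    exact mul_le_mul_of_nonneg_right (hM k p) (abs_nonneg _)
  set D := M * ∫ p in Om a b, |f p| with hD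
  have hD0 : 0 ≤ D := (abs_nonneg _).trans (hdb 0)
  have hsum : Summable fun k => ((1 + mu a b k) * (d k / mu a b k ^ 2)) ^ 2 := by
    refine Summable.of_nonneg_of_le (fun k => sq_nonneg _) (fun k => ?_)
      ((summable_one_add_mu ha hb).mul_left (((1 + κ⁻¹) ^ 2 * D) ^ 2))
    rw [← mul_pow, ← sq_abs]
    refine pow_le_pow_left₀ (abs_nonneg _) ?_ 2
    have hp : 0 < 1 + mu a b k := by linarith [mu_nonneg a b k]
    rcases eq_or_ne k 0 with rfl | hk
    · rw [hd0]; simp [mu_zero]; positivity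
    · have hm := mu_pos ha hb hk
      have h1 := pow_le_pow_left₀ hp.le (one_add_mu_le hκ (hgap k hk)) 2
      rw [abs_mul, abs_div, abs_of_pos hp, abs_of_pos (pow_pos hm 2), ← mul_div_assoc,
        ← div_eq_mul_inv, div_le_div_iff₀ (pow_pos hm 2) hp]
      calc (1 + mu a b k) * |d k| * (1 + mu a b k) = (1 + mu a b k) ^ 2 * |d k| := by ring
        _ ≤ ((1 + κ⁻¹) * mu a b k) ^ 2 * D := mul_le_mul h1 (hdb k) (abs_nonneg _) (sq_nonneg _)
        _ = _ := by ring
  obtain ⟨φ, hφ, hc⟩ := exists_mem_V_of_coef ha hb _ hsum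
  refine ⟨φ, ⟨mem_X_of_coef ha hb hφ (by rw [hc, mu_zero]; simp), fun ψ hψ => ?_⟩, fun φ' h' => ?_⟩
  · rw [← inner_eq]
    refine (hasSum_lap ha hb hφ hψ).unique ?_
    refine hasSum_of_eq (hasSum_integral_mul ha hb hf ψ.val (summable_abs_coef ha hb hψ)) fun k => ?_
    rw [hc]
    change _ = _ * d k
    rcases eq_or_ne k 0 with rfl | hk
    · rw [hd0, mu_zero]; simp
    · have hm := (mu_pos ha hb hk).ne'
      field_simp
  · exact ext_of_mem_V ha hb h'.1.1 hφ fun k => by rw [h'.coef ha hb, hc]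

theorem isSol_sol {a b : ℝ} {f : ℝ × ℝ → ℝ} (h : ∃! φ : H2 a b, IsSol f φ) :
    IsSol f (sol f : H2 a b) := by
  rw [sol, dif_pos h.exists]
  exact h.exists.choose_spec

/-! ### The right-hand sides of the three problems -/

section Rhs

variable {a b : ℝ} {w : H2 a b}

theorem integrable_bracket (w : H2 a b) : IntegrableOn (bracket w w) (Om a b) :=
  (((integrable_mul_L2 w.dxx w.dyy).const_mul _).add
    ((integrable_mul_L2 w.dyy w.dxx).const_mul _)).sub (integrable_mul_L2 w.dxy w.dxy)

theorem integral_bracket (ha : 0 < a) (hb : 0 < b) (hw : w ∈ V a b) :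
    ∫ p in Om a b, bracket w w p = 0 := by
  have e : ∀ p, bracket w w p = w.dxx p * w.dyy p - w.dxy p * w.dxy p := fun p => by
    rw [bracket]; ring
  simp_rw [e]
  rw [integral_sub (integrable_mul_L2 _ _) (integrable_mul_L2 _ _), ← inner_eq, ← inner_eq,
    inner_dxx_dyy ha hb hw, sub_self]

/-- By the arithmetic-geometric inequality the bracket is at most `½ w_xx² + ½ w_yy² + w_xy²`. Each
squared norm is at most that of `Δw`, and the weights add up to `2`. -/
theorem integral_abs_bracket_le (ha : 0 < a) (hb : 0 < b) (hw : w ∈ V a b) :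
    ∫ p in Om a b, |bracket w w p| ≤ 2 * inner ℝ (lap w) (lap w) := by
  have h : ∫ p in Om a b, |bracket w w p| ≤ ∫ p in Om a b, ((1 / 2 * (w.dxx p * w.dxx p) +
      1 / 2 * (w.dyy p * w.dyy p)) + w.dxy p * w.dxy p) := by
    refine integral_mono (integrable_bracket w).abs ((((integrable_mul_L2 w.dxx w.dxx).const_mul _).add
      ((integrable_mul_L2 w.dyy w.dyy).const_mul _)).add (integrable_mul_L2 w.dxy w.dxy)) fun p => ?_
    simp only [bracket]
    rw [abs_le]
    constructor <;> nlinarith [sq_nonneg (w.dxx p + w.dyy p), sq_nonneg (w.dxx p - w.dyy p),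
      sq_nonneg (w.dxy p)]
  have i1 : IntegrableOn (fun p => 1 / 2 * (w.dxx p * w.dxx p) + 1 / 2 * (w.dyy p * w.dyy p))
      (Om a b) :=
    ((integrable_mul_L2 w.dxx w.dxx).const_mul _).add ((integrable_mul_L2 w.dyy w.dyy).const_mul _)
  rw [integral_add i1 (integrable_mul_L2 w.dxy w.dxy),
    integral_add ((integrable_mul_L2 w.dxx w.dxx).const_mul _)
      ((integrable_mul_L2 w.dyy w.dyy).const_mul _), integral_const_mul, integral_const_mul,
    ← inner_eq, ← inner_eq, ← inner_eq] at h
  linarith [inner_dxx_le ha hb hw, inner_dyy_le ha hb hw, inner_dxy_le ha hb hw]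

theorem integral_dxx (ha : 0 < a) (hb : 0 < b) (hw : w ∈ V a b) : ∫ p in Om a b, w.dxx p = 0 := by
  have h := inner_dxx ha hb hw 0
  rw [inner_eL] at h
  simp_rw [eF_zero] at h
  rw [integral_mul_const] at h
  refine (mul_eq_zero.1 (h.trans ?_)).resolve_right (nrm_ne_zero ha hb 0)
  simp

theorem existsUnique_phi1 (ha : 0 < a) (hb : 0 < b) (hw : w ∈ V a b) :
    ∃! φ : H2 a b, IsSol (rhs1 w) φ :=
  existsUnique_isSol ha hb (integrable_L2 w.dxx).neg (by
    simp only [rhs1]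
    rw [integral_neg, integral_dxx ha hb hw, neg_zero])

theorem existsUnique_phi2 (ha : 0 < a) (hb : 0 < b) (hw : w ∈ V a b) :
    ∃! φ : H2 a b, IsSol (rhs2 w) φ :=
  existsUnique_isSol ha hb (integrable_bracket w).neg (by
    simp only [rhs2]
    rw [integral_neg, integral_bracket ha hb hw, neg_zero])

theorem existsUnique_phi (ha : 0 < a) (hb : 0 < b) (hw : w ∈ V a b) :
    ∃! φ : H2 a b, IsSol (rhs w) φ :=
  existsUnique_isSol ha hb ((integrable_bracket w).neg.sub (integrable_L2 w.dxx)) (by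
    simp only [rhs]
    rw [integral_sub (by exact (integrable_bracket w).neg) (integrable_L2 w.dxx), integral_neg,
      integral_dxx ha hb hw, integral_bracket ha hb hw, neg_zero, sub_zero])

theorem isSol_phi1 (ha : 0 < a) (hb : 0 < b) (hw : w ∈ V a b) : IsSol (rhs1 w) (phi1 w) :=
  isSol_sol (existsUnique_phi1 ha hb hw)

theorem isSol_phi2 (ha : 0 < a) (hb : 0 < b) (hw : w ∈ V a b) : IsSol (rhs2 w) (phi2 w) :=
  isSol_sol (existsUnique_phi2 ha hb hw)

theorem isSol_phi (ha : 0 < a) (hb : 0 < b) (hw : w ∈ V a b) : IsSol (rhs w) (phi w) :=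
  isSol_sol (existsUnique_phi ha hb hw)

/-- The coefficients of a weak solution are linear in the right-hand side. -/
theorem lap_phi (ha : 0 < a) (hb : 0 < b) (hw : w ∈ V a b) :
    lap (phi w) = lap (phi1 w) + lap (phi2 w) := by
  have h := isSol_phi ha hb hw
  have h1 := isSol_phi1 ha hb hw
  have h2 := isSol_phi2 ha hb hw
  refine eL_ext ha hb fun k => ?_
  have hc : ∫ p in Om a b, rhs w p * eF a b k p =
      (∫ p in Om a b, rhs1 w p * eF a b k p) + ∫ p in Om a b, rhs2 w p * eF a b k p := by
    have i1 : IntegrableOn (rhs1 w) (Om a b) := (integrable_L2 w.dxx).neg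
    have i2 : IntegrableOn (rhs2 w) (Om a b) := (integrable_bracket w).neg
    rw [← integral_add (integrable_mul_of_continuous i1 (contDiff_eF a b k).continuous)
      (integrable_mul_of_continuous i2 (contDiff_eF a b k).continuous)]
    congr 1; ext p
    simp only [rhs, rhs1, rhs2]; ring
  rw [inner_add_left, inner_lap ha hb h.1.1, inner_lap ha hb h1.1.1, inner_lap ha hb h2.1.1,
    h.coef ha hb, h1.coef ha hb, h2.coef ha hb, hc]
  ring

end Rhs

/-! ### Estimates on the potential -/

section Potential

variable {a b : ℝ} {w : H2 a b}

theorem integral_sq_add_sq (u v : L2 a b) :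
    ∫ p in Om a b, ((u p) ^ 2 + (v p) ^ 2) = inner ℝ u u + inner ℝ v v := by
  simp_rw [sq]
  rw [integral_add (integrable_mul_L2 u u) (integrable_mul_L2 v v), ← inner_eq, ← inner_eq]

theorem normX_sq (w : H2 a b) :
    normX w ^ 2 = inner ℝ (lap w) (lap w) + inner ℝ (lap (phi1 w)) (lap (phi1 w)) := by
  rw [normX, integral_sq_add_sq, Real.sq_sqrt (add_nonneg real_inner_self_nonneg real_inner_self_nonneg)]

theorem normX_nonneg (w : H2 a b) : 0 ≤ normX w := Real.sqrt_nonneg _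

theorem F_eq (lam : ℝ) (w : H2 a b) :
    F lam w = 1 / 2 * (inner ℝ (lap w) (lap w) + inner ℝ (lap (phi w)) (lap (phi w))) -
      lam * (1 / 2 * inner ℝ w.dx w.dx) := by
  rw [F, energy, shortening, integral_sq_add_sq]
  simp_rw [sq]
  rw [← inner_eq]

/-- The shortening is controlled by the norm of `X`. -/
theorem inner_dx_le (ha : 0 < a) (hb : 0 < b) (hw : w ∈ V a b) :
    inner ℝ w.dx w.dx ≤ normX w ^ 2 / 2 := by
  -- Testing the equation of `φ₁` with `w` itself turns the shortening integral into `∫ Δφ₁ Δw`;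
  -- `h0` then gives `2xy ≤ x² + y²`.
  have h := (isSol_phi1 ha hb hw).inner_lap_eq hw
  have e : ∫ p in Om a b, rhs1 w p * w.val p = inner ℝ w.dx w.dx := by
    simp_rw [rhs1, neg_mul]
    rw [integral_neg, ← inner_eq, inner_dxx_val ha hb hw, neg_neg]
  have h0 : 0 ≤ inner ℝ (lap w - lap (phi1 w)) (lap w - lap (phi1 w)) := real_inner_self_nonneg
  rw [inner_sub_left, inner_sub_right, inner_sub_right, real_inner_comm (lap (phi1 w)) (lap w)] at h0
  rw [normX_sq]
  linarith

/-- The bound on the cubic term of the energy. -/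
theorem exists_cubic_bound (ha : 0 < a) (hb : 0 < b) : ∃ C, 0 ≤ C ∧ ∀ w ∈ X a b,
    |inner ℝ (lap (phi1 w)) (lap (phi2 w))| ≤ C * normX w ^ 3 := by
  obtain ⟨K, hK0, hK⟩ := exists_sup_bound ha hb
  refine ⟨2 * K, by positivity, fun w hw => ?_⟩
  have h1 := isSol_phi1 ha hb hw.1
  have hN := normX_nonneg w
  have hN2 := normX_sq w
  have hA : 0 ≤ inner ℝ (lap w) (lap w) := real_inner_self_nonneg
  have hB : 0 ≤ inner ℝ (lap (phi1 w)) (lap (phi1 w)) := real_inner_self_nonneg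
  set s := Real.sqrt (inner ℝ (lap (phi1 w)) (lap (phi1 w))) with hs
  have hsN : s ≤ normX w := Real.sqrt_le_iff.2 ⟨hN, by linarith⟩
  -- Testing the equation of `φ₂` with `φ₁` leaves an `L¹` bracket against a bounded function.
  rw [real_inner_comm, (isSol_phi2 ha hb hw.1).inner_lap_eq h1.1.1]
  calc |∫ p in Om a b, rhs2 w p * (phi1 w).val p|
      ≤ ∫ p in Om a b, |bracket w w p| * (K * s) := by
        rw [← Real.norm_eq_abs]
        refine norm_integral_le_of_norm_le ((integrable_bracket w).abs.mul_const _) ?_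
        filter_upwards [hK _ h1.1] with p hp
        rw [rhs2, norm_mul, norm_neg]
        exact mul_le_mul_of_nonneg_left hp (norm_nonneg _)
    _ = (∫ p in Om a b, |bracket w w p|) * (K * s) := integral_mul_const _ _
    _ ≤ (2 * normX w ^ 2) * (K * normX w) := by
        refine mul_le_mul ?_ (mul_le_mul_of_nonneg_left hsN hK0)
          (mul_nonneg hK0 (Real.sqrt_nonneg _)) (by positivity)
        linarith [integral_abs_bracket_le ha hb hw.1]
    _ = 2 * K * normX w ^ 3 := by ring

/-- The quadratic part is at least `½ - λ/4 = 2c` times `‖w‖_X²`, with `c = (2 - λ)/8`. One `c` is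
kept and the other absorbs the cubic term when `C ‖w‖_X ≤ c`. The radius `c / (C + 1)` ensures this,
also for `C = 0`. -/
theorem exists_F_lower_bound (ha : 0 < a) (hb : 0 < b) {lam : ℝ} (h0 : 0 < lam) (h2 : lam < 2) :
    ∃ r > 0, ∃ c > 0, ∀ w ∈ X a b, normX w ≤ r → c * normX w ^ 2 ≤ F lam w := by
  obtain ⟨C, hC0, hC⟩ := exists_cubic_bound ha hb
  set c := (2 - lam) / 8 with hc
  have hc0 : 0 < c := by rw [hc]; linarith
  refine ⟨c / (C + 1), by positivity, c, hc0, fun w hw hr => ?_⟩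
  have hN := normX_nonneg w
  have hN2 := normX_sq w
  have hdx := inner_dx_le ha hb hw.1
  have hcub := (abs_le.1 (hC w hw)).1
  have hCC : 0 ≤ inner ℝ (lap (phi2 w)) (lap (phi2 w)) := real_inner_self_nonneg
  have hCN : C * normX w ≤ c := by
    rw [le_div_iff₀ (by linarith)] at hr
    linarith
  have h3 : C * normX w ^ 3 ≤ c * normX w ^ 2 := by
    have := mul_le_mul_of_nonneg_right hCN (sq_nonneg (normX w))
    linarith
  have hlam := mul_le_mul_of_nonneg_left hdx h0.le
  rw [F_eq, lap_phi ha hb hw.1, inner_add_left, inner_add_right, inner_add_right,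
    real_inner_comm (lap (phi1 w)) (lap (phi2 w))]
  have e : c * normX w ^ 2 = (2 - lam) / 8 * normX w ^ 2 := rfl
  linarith

/-- Spheres of `X` must be shown nonempty, since `sInf ∅ = 0` would contradict positivity of the
infimum. A mode independent of `x` has `w_xx = 0`, hence `Δφ₁ = 0`, and its norm is explicit. -/
theorem exists_mem_X_normX_eq (ha : 0 < a) (hb : 0 < b) {ρ : ℝ} (hρ : 0 ≤ ρ) :
    ∃ w ∈ X a b, normX w = ρ := by
  have hk : ((0, 1) : ℕ × ℤ) ≠ 0 := by simp
  have hm := (mu_pos ha hb hk).ne'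
  obtain ⟨w, hw, hv, hxx, hl⟩ := exists_eigenfunction ha hb (0, 1) (ρ / mu a b (0, 1))
  have ho := orthonormal_iff_ite.1 (orthonormal_eL ha hb) (0, 1)
  refine ⟨w, mem_X_of_coef ha hb hw ?_, ?_⟩
  · rw [hv, real_inner_smul_left, ho, if_neg hk, mul_zero]
  · have h1 : lap (phi1 w) = 0 := by
      have h := isSol_phi1 ha hb hw
      refine eL_ext ha hb fun k => ?_
      have hz : ∫ p in Om a b, rhs1 w p * eF a b k p = 0 := by
        simp_rw [rhs1, neg_mul]
        rw [integral_neg, ← inner_eL, hxx]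
        simp
      rw [inner_lap ha hb h.1.1, h.coef ha hb, hz]
      simp
    have h2 : normX w ^ 2 = ρ ^ 2 := by
      rw [normX_sq, h1, hl, real_inner_smul_left, real_inner_smul_right, ho, mul_div_cancel₀ _ hm]
      simp
      ring
    exact (sq_eq_sq₀ (normX_nonneg w) hρ).1 h2

theorem zero_mem_V : (0 : H2 a b) ∈ V a b :=
  ⟨fun η _ => green_zero ex η, fun η _ _ => green_zero ey η, fun η _ _ => green_zero ey η⟩

theorem F_zero (ha : 0 < a) (hb : 0 < b) (lam : ℝ) : F lam (0 : H2 a b) = 0 := by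
  have h := isSol_phi ha hb (zero_mem_V (a := a) (b := b))
  have hz : ∫ p in Om a b, rhs (0 : H2 a b) p * (phi (0 : H2 a b)).val p = 0 := by
    refine integral_eq_zero_of_ae ?_
    filter_upwards [Lp.coeFn_zero ℝ 2 ((volume : Measure (ℝ × ℝ)).restrict (Om a b))] with p hp
    have h1 : (0 : H2 a b).dxx p = 0 := hp
    have h2 : (0 : H2 a b).dxy p = 0 := hp
    simp [rhs, bracket, h1, h2]
  have hl : lap (0 : H2 a b) = 0 := add_zero (0 : L2 a b)
  have hx : (0 : H2 a b).dx = 0 := rfl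
  rw [F_eq, h.inner_lap_eq h.1.1, hz, hl, hx]
  simp

/-- If the norm vanishes then `Δw = 0`, which kills every mode with `mu > 0`; the remaining mode is
excluded by mean zero. -/
theorem normX_pos (ha : 0 < a) (hb : 0 < b) (hw : w ∈ X a b) (h0 : w ≠ 0) : 0 < normX w := by
  refine lt_of_le_of_ne (normX_nonneg w) fun h => h0 ?_
  have hN := normX_sq w
  have hA : 0 ≤ inner ℝ (lap w) (lap w) := real_inner_self_nonneg
  have hB : 0 ≤ inner ℝ (lap (phi1 w)) (lap (phi1 w)) := real_inner_self_nonneg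
  rw [← h] at hN
  have hl : lap w = 0 := inner_self_eq_zero.1 (by linarith : inner ℝ (lap w) (lap w) = 0)
  refine ext_of_mem_V ha hb hw.1 zero_mem_V fun k => ?_
  have hz : (0 : H2 a b).val = 0 := rfl
  rw [hz, inner_zero_left]
  rcases eq_or_ne k 0 with rfl | hk
  · exact inner_eL_zero a b hw
  · have := inner_lap ha hb hw.1 k
    rw [hl, inner_zero_left, eq_comm, neg_eq_zero] at this
    exact (mul_eq_zero.1 this).resolve_left (mu_pos ha hb hk).ne'

end Potential

end VKD

theorem lemma3p1 (a b : ℝ) (ha : 0 < a) (hb : 0 < b) :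
    -- the functions `φ₁`, `φ₂`, `φ` are well defined on `X`
    (∀ w ∈ VKD.X a b,
      (∃! φ₁ : VKD.H2 a b, VKD.IsSol (VKD.rhs1 w) φ₁) ∧
      (∃! φ₂ : VKD.H2 a b, VKD.IsSol (VKD.rhs2 w) φ₂) ∧
      (∃! φ : VKD.H2 a b, VKD.IsSol (VKD.rhs w) φ)) ∧
    -- the cubic term of the energy
    (∃ C : ℝ, ∀ w ∈ VKD.X a b,
      |∫ p in VKD.Om a b, VKD.lap (VKD.phi1 w) p * VKD.lap (VKD.phi2 w) p|
        ≤ C * VKD.normX w ^ 3) ∧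
    -- the infimum of `F_λ` over a small sphere of `X` is positive
    -- (so this set of reals is nonempty and bounded below)
    (∀ lam : ℝ, 0 < lam → lam < 2 → ∃ ρ : ℝ, 0 < ρ ∧
      0 < sInf (VKD.F lam '' {w : VKD.H2 a b | w ∈ VKD.X a b ∧ VKD.normX w = ρ})) ∧
    -- the origin is a strict local minimizer of `F_λ` in `X`
    (∀ lam : ℝ, 0 < lam → lam < 2 → ∃ r : ℝ, 0 < r ∧
      ∀ w ∈ VKD.X a b, w ≠ 0 → VKD.normX w ≤ r →
        VKD.F lam (0 : VKD.H2 a b) < VKD.F lam w) := by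
  refine ⟨fun w hw => ⟨VKD.existsUnique_phi1 ha hb hw.1, VKD.existsUnique_phi2 ha hb hw.1,
    VKD.existsUnique_phi ha hb hw.1⟩, ?_, fun lam h0 h2 => ?_, fun lam h0 h2 => ?_⟩
  · obtain ⟨C, -, hC⟩ := VKD.exists_cubic_bound ha hb
    refine ⟨C, fun w hw => ?_⟩
    rw [← VKD.inner_eq]
    exact hC w hw
  · obtain ⟨r, hr, c, hc, h⟩ := VKD.exists_F_lower_bound ha hb h0 h2
    -- The sphere is taken at the full radius `r`, where `c r²` is a positive lower bound for `F_λ`.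
    refine ⟨r, hr, lt_of_lt_of_le (by positivity : 0 < c * r ^ 2) (le_csInf ?_ ?_)⟩
    · obtain ⟨w, hw, hN⟩ := VKD.exists_mem_X_normX_eq ha hb hr.le
      exact ⟨_, w, ⟨hw, hN⟩, rfl⟩
    · rintro _ ⟨w, ⟨hw, hN⟩, rfl⟩
      have := h w hw hN.le
      rwa [hN] at this
  · obtain ⟨r, hr, c, hc, h⟩ := VKD.exists_F_lower_bound ha hb h0 h2
    refine ⟨r, hr, fun w hw hw0 hN => ?_⟩
    rw [VKD.F_zero ha hb]
    exact lt_of_lt_of_le (mul_pos hc (pow_pos (VKD.normX_pos ha hb hw hw0) 2)) (h w hw hN)
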